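/- Let $\mathbb T^2=(S^1\times S^1,\,d\gamma^2+d\vartheta^2)$, $0\le\gamma,\vartheta\le 2\pi$, be the flat torus, let $S^2\subset\mathbb R^3$ be the unit sphere, let $k\ge 1$ be an integer, and let $\varphi=\varphi_k:\mathbb T^2\to S^2$ be the proper biharmonic map $$(\gamma,\vartheta)\mapsto\left(\sin\tfrac{\pi}{4}\cos k\gamma,\ \sin\tfrac{\pi}{4}\sin k\gamma,\ \cos\tfrac{\pi}{4}\right).$$ Let $I_2$ be the second variation operator of the bienergy $E_2(\varphi)=\frac12\int|\tau(\varphi)|^2$ at $\varphi$, acting on the space $\mathcal C(\varphi^{-1}TS^2)$ of smooth sections of $\varphi^{-1}TS^2$; explicitly, with $e_1=\partial_\gamma$, $e_2=\partial_\vartheta$, $\varphi_i=d\varphi(e_i)$, $\nabla_i=\nabla^{\varphi}_{e_i}$ the pull-back of the Levi-Civita connection, $\overline\Delta=-\sum_i\nabla_i\nabla_i$, $\tau=\sum_i\nabla_i\varphi_i$ and $T(V)=\sum_i\langle V,\varphi_i\rangle\varphi_i$, $$\begin{aligned}I_2(V)=\ &\overline\Delta^2V+\overline\Delta\big(T(V)-|d\varphi|^2V\big)+2\sum_i\langle\nabla_i\tau,\varphi_i\rangle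 V+|\tau|^2V-2\sum_i\langle V,\nabla_i\tau\rangle\varphi_i-2\sum_i\langle\tau,\nabla_iV\rangle\varphi_i-\langle\tau,V\rangle\tau\\&+T(\overline\Delta V)+T(T(V))-2|d\varphi|^2T(V)+2\sum_i\langle\nabla_iV,\varphi_i\rangle\tau-|d\varphi|^2\,\overline\Delta V+|d\varphi|^4V.\end{aligned}$$ Consider the following list of real numbers, with multiplicities $\nu$: * $\mu_0=0$ and $\mu_1=-k^4$, with $\nu(\mu_0)=\nu(\mu_1)=1$; * for $m\ge1$, $n=0$: $\ \lambda^{\pm}_{m,0}=\frac12\left(-k^4+5k^2m^2+2m^4\pm\sqrt{k^8+2k^6m^2+k^4m^4+32k^2m^6}\right)$, with $\nu(\lambda^{\pm}_{m,0})=2$; * for $m=0$, $n\ge1$: $\ \lambda^+_{0,n}=n^2(n^2+k^2)$ and $\lambda^-_{0,n}=n^4-k^4$, with $\nu(\lambda^{\pm}_{0,n})=2$; * for $m,n\ge1$: $\ \lambda^{\pm}_{m,n}=\frac12\left(-k^4+k^2(5m^2+n^2)+2(m^2+n^2)^2\pm\sqrt{k^8+2k^6(m^2+n^2)+k^4(m^2+n^2)^2+32k^2m^2(m^2+n^2)^2}\right)$,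 with $\nu(\lambda^{\pm}_{m,n})=4$. Then the spectrum of $I_2$ is given by this list, counted with multiplicity (different entries of the list may have the same value). That is: 1. a real number is an eigenvalue of $I_2$ if and only if it is the value of an entry of the list; 2. for every real $\mu$, only finitely many entries of the list have the value $\mu$, and the eigenspace $\{V:I_2(V)=\mu V\}$ has finite dimension, equal to the sum of the multiplicities $\nu$ of those entries; 3. there is an $L^2$-orthonormal family of smooth eigensections of $I_2$, consisting of exactly $\nu$ eigensections for each entry of the list, with that entry as eigenvalue, whose linear span is $L^2$-dense in $\mathcal C(\varphi^{-1}TS^2)$. -/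

import Mathlib

open Real
open scoped ContDiff

noncomputable section

namespace BiharmonicTorus

/-! ### The flat torus

The flat torus `𝕋² = (S¹ × S¹, dγ² + dϑ²)`, `0 ≤ γ, ϑ ≤ 2π`, is the quotient of the plane with
coordinates `(γ, ϑ)` by the lattice `2πℤ × 2πℤ`. A smooth map on `𝕋²` is a smooth map on the plane
that is `2π`-periodic in each variable. The fields `∂/∂γ`, `∂/∂ϑ` form a global orthonormal frame
that is parallel for the Levi-Civita connection. -/

/-- The Euclidean space `ℝ³` that contains the unit sphere `S²`. -/
abbrev E3 : Type := EuclideanSpace ℝ (Fin 3)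

/-- Smooth maps on the flat torus with values in a normed space. -/
structure SmoothOnTorus {F : Type*} [NormedAddCommGroup F] [NormedSpace ℝ F]
    (f : ℝ × ℝ → F) : Prop where
  smooth : ContDiff ℝ ∞ f
  periodic_fst : ∀ γ ϑ : ℝ, f (γ + 2 * π, ϑ) = f (γ, ϑ)
  periodic_snd : ∀ γ ϑ : ℝ, f (γ, ϑ + 2 * π) = f (γ, ϑ)

/-- The orthonormal frame `e₀ = ∂/∂γ`, `e₁ = ∂/∂ϑ`. -/
def frame : Fin 2 → ℝ × ℝ := ![(1, 0), (0, 1)]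

/-- The derivative of `f` in the direction `eᵢ`. -/
def partialD {F : Type*} [NormedAddCommGroup F] [NormedSpace ℝ F]
    (i : Fin 2) (f : ℝ × ℝ → F) : ℝ × ℝ → F :=
  fun p => fderiv ℝ f p (frame i)

/-! ### Maps into the sphere, sections and the operator `I₂` -/

/-- Smooth maps `𝕋² → S² ⊂ ℝ³`. -/
structure SphereMap where
  toFun : ℝ × ℝ → E3
  smoothOnTorus : SmoothOnTorus toFun
  norm_eq_one : ∀ p, ‖toFun p‖ = 1

/-- `dφ(eᵢ)`. -/
def dmap (φ : SphereMap) (i : Fin 2) : ℝ × ℝ → E3 := partialD i φ.toFun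

/-- The pull-back connection: `∇^φ_{eᵢ} V` is the component of `∂V/∂eᵢ` tangent to `S²` at `φ`. -/
def nabla (φ : SphereMap) (i : Fin 2) (V : ℝ × ℝ → E3) : ℝ × ℝ → E3 :=
  fun p => partialD i V p - (inner ℝ (φ.toFun p) (partialD i V p)) • φ.toFun p

/-- The rough Laplacian `Δ̄ V = -∑ᵢ ∇^φ_{eᵢ} ∇^φ_{eᵢ} V` (the frame is parallel). -/
def roughLaplacian (φ : SphereMap) (V : ℝ × ℝ → E3) : ℝ × ℝ → E3 :=
  fun p => -∑ i, nabla φ i (nabla φ i V) p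

/-- The tension field `τ(φ) = trace ∇dφ`. -/
def tension (φ : SphereMap) : ℝ × ℝ → E3 :=
  fun p => ∑ i, nabla φ i (dmap φ i) p

/-- `|dφ|²`. -/
def normSqD (φ : SphereMap) : ℝ × ℝ → ℝ :=
  fun p => ∑ i, ‖dmap φ i p‖ ^ 2

/-- `trace ⟨V, dφ ·⟩ dφ ·`. -/
def traceD (φ : SphereMap) (V : ℝ × ℝ → E3) : ℝ × ℝ → E3 :=
  fun p => ∑ i, (inner ℝ (V p) (dmap φ i p)) • dmap φ i p

/-- `⟨dV, dφ⟩ = ∑ᵢ ⟨∇^φ_{eᵢ} V, dφ(eᵢ)⟩`. -/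
def pairingD (φ : SphereMap) (V : ℝ × ℝ → E3) : ℝ × ℝ → ℝ :=
  fun p => ∑ i, inner ℝ (nabla φ i V p) (dmap φ i p)

/-- The expression of the second variation operator `I₂(V)` of the bienergy
`E₂(φ) = ½ ∫ |τ(φ)|²` for a map into a unit sphere. -/
def secondVariation (φ : SphereMap) (V : ℝ × ℝ → E3) : ℝ × ℝ → E3 := fun p =>
  roughLaplacian φ (roughLaplacian φ V) p
    + roughLaplacian φ (fun q => traceD φ V q - normSqD φ q • V q) p
    + (2 * pairingD φ (tension φ) p) • V p
    + (‖tension φ p‖ ^ 2) • V p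
    - (2 : ℝ) • ∑ i, (inner ℝ (V p) (nabla φ i (tension φ) p)) • dmap φ i p
    - (2 : ℝ) • ∑ i, (inner ℝ (tension φ p) (nabla φ i V p)) • dmap φ i p
    - (inner ℝ (tension φ p) (V p)) • tension φ p
    + traceD φ (roughLaplacian φ V) p
    + traceD φ (traceD φ V) p
    - (2 * normSqD φ p) • traceD φ V p
    + (2 * pairingD φ V p) • tension φ p
    - normSqD φ p • roughLaplacian φ V p
    + (normSqD φ p ^ 2) • V p

/-! ### Facts needed to see `I₂` as a linear operator on the space of smooth sections -/

section Facts

variable {F : Type*} [NormedAddCommGroup F] [NormedSpace ℝ F]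

theorem SmoothOnTorus.add {f g : ℝ × ℝ → F} (hf : SmoothOnTorus f) (hg : SmoothOnTorus g) :
    SmoothOnTorus (fun p => f p + g p) :=
  ⟨hf.smooth.add hg.smooth, fun a b => by simp [hf.periodic_fst a b, hg.periodic_fst a b],
    fun a b => by simp [hf.periodic_snd a b, hg.periodic_snd a b]⟩

theorem SmoothOnTorus.smul {c : ℝ × ℝ → ℝ} {f : ℝ × ℝ → F} (hc : SmoothOnTorus c)
    (hf : SmoothOnTorus f) : SmoothOnTorus (fun p => c p • f p) :=
  ⟨hc.smooth.smul hf.smooth, fun a b => by simp [hf.periodic_fst a b, hc.periodic_fst a b],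
    fun a b => by simp [hf.periodic_snd a b, hc.periodic_snd a b]⟩

theorem SmoothOnTorus.const (c : F) : SmoothOnTorus (fun _ : ℝ × ℝ => c) :=
  ⟨contDiff_const, fun _ _ => rfl, fun _ _ => rfl⟩

theorem SmoothOnTorus.inner {f g : ℝ × ℝ → E3} (hf : SmoothOnTorus f) (hg : SmoothOnTorus g) :
    SmoothOnTorus (fun p => inner ℝ (f p) (g p)) :=
  ⟨hf.smooth.inner ℝ hg.smooth, fun a b => by simp [hf.periodic_fst a b, hg.periodic_fst a b],
    fun a b => by simp [hf.periodic_snd a b, hg.periodic_snd a b]⟩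

theorem SmoothOnTorus.partialD {f : ℝ × ℝ → F} (hf : SmoothOnTorus f) (i : Fin 2) :
    SmoothOnTorus (partialD i f) := by
  have key : ∀ v : ℝ × ℝ, (∀ q, f (q + v) = f q) → ∀ q, fderiv ℝ f (q + v) = fderiv ℝ f q := by
    intro v hv q
    have h1 : (fun q => f (q + v)) = f := funext hv
    have h2 := fderiv_comp_add_right (𝕜 := ℝ) (f := f) (x := q) v
    rw [h1] at h2
    exact h2.symm
  refine ⟨?_, fun a b => ?_, fun a b => ?_⟩
  · exact (hf.smooth.fderiv_right (m := ∞) (by simp)).clm_apply contDiff_const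
  · have h := key (2 * π, 0) (fun ⟨c, d⟩ => by simpa using hf.periodic_fst c d) (a, b)
    simp only [Prod.mk_add_mk, add_zero] at h
    simp [BiharmonicTorus.partialD, h]
  · have h := key (0, 2 * π) (fun ⟨c, d⟩ => by simpa using hf.periodic_snd c d) (a, b)
    simp only [Prod.mk_add_mk, add_zero] at h
    simp [BiharmonicTorus.partialD, h]

theorem partialD_add {f g : ℝ × ℝ → F} (hf : SmoothOnTorus f) (hg : SmoothOnTorus g) (i : Fin 2)
    (p : ℝ × ℝ) : partialD i (fun q => f q + g q) p = partialD i f p + partialD i g p := by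
  have h1 := (hf.smooth.differentiable (by simp)) p
  have h2 := (hg.smooth.differentiable (by simp)) p
  simp [partialD, fderiv_fun_add h1 h2]

theorem partialD_const_smul {f : ℝ × ℝ → F} (hf : SmoothOnTorus f) (c : ℝ) (i : Fin 2)
    (p : ℝ × ℝ) : partialD i (fun q => c • f q) p = c • partialD i f p := by
  have h1 := (hf.smooth.differentiable (by simp)) p
  simp [partialD, fderiv_fun_const_smul h1 c]

end Facts

/-- Smooth sections of `φ⁻¹ T S²`: smooth vector fields `V` along `φ` with `V(p) ∈ T_{φ(p)} S²`. -/
def IsSection (φ : SphereMap) (V : ℝ × ℝ → E3) : Prop :=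
  SmoothOnTorus V ∧ ∀ p, inner ℝ (φ.toFun p) (V p) = (0 : ℝ)

section Facts

variable {φ : SphereMap} {V W : ℝ × ℝ → E3}

theorem IsSection.add (hV : IsSection φ V) (hW : IsSection φ W) :
    IsSection φ (fun p => V p + W p) :=
  ⟨hV.1.add hW.1, fun p => by simp [inner_add_right, hV.2 p, hW.2 p]⟩

theorem IsSection.smul {c : ℝ × ℝ → ℝ} (hc : SmoothOnTorus c) (hV : IsSection φ V) :
    IsSection φ (fun p => c p • V p) :=
  ⟨hc.smul hV.1, fun p => by simp [inner_smul_right, hV.2 p]⟩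

theorem IsSection.const_smul (c : ℝ) (hV : IsSection φ V) : IsSection φ (fun p => c • V p) :=
  IsSection.smul (SmoothOnTorus.const c) hV

theorem IsSection.neg (hV : IsSection φ V) : IsSection φ (fun p => -V p) := by
  simpa using IsSection.const_smul (-1) hV

theorem IsSection.sub (hV : IsSection φ V) (hW : IsSection φ W) :
    IsSection φ (fun p => V p - W p) := by
  simpa [sub_eq_add_neg] using IsSection.add hV hW.neg

theorem IsSection.sum {V : Fin 2 → ℝ × ℝ → E3} (hV : ∀ i, IsSection φ (V i)) :
    IsSection φ (fun p => ∑ i, V i p) := by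
  simpa [Fin.sum_univ_two] using IsSection.add (hV 0) (hV 1)

theorem SmoothOnTorus.sum {c : Fin 2 → ℝ × ℝ → ℝ} (hc : ∀ i, SmoothOnTorus (c i)) :
    SmoothOnTorus (fun p => ∑ i, c i p) := by
  simpa [Fin.sum_univ_two] using SmoothOnTorus.add (hc 0) (hc 1)

theorem isSection_nabla (hV : SmoothOnTorus V) (i : Fin 2) : IsSection φ (nabla φ i V) := by
  have h1 := hV.partialD i
  have h2 := (φ.smoothOnTorus.inner h1).smul φ.smoothOnTorus
  refine ⟨?_, fun p => ?_⟩
  · have h3 := h1.add ((SmoothOnTorus.const (-1 : ℝ)).smul h2)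
    have e : nabla φ i V = fun p => partialD i V p
        + (-1 : ℝ) • ((inner ℝ (φ.toFun p) (partialD i V p)) • φ.toFun p) := by
      funext p
      simp only [nabla]
      module
    rw [e]
    exact h3
  · simp [nabla, inner_sub_right, inner_smul_right, φ.norm_eq_one p]

theorem isSection_dmap (i : Fin 2) : IsSection φ (dmap φ i) := by
  refine ⟨φ.smoothOnTorus.partialD i, fun p => ?_⟩
  have hd : DifferentiableAt ℝ φ.toFun p := φ.smoothOnTorus.smooth.differentiable (by simp) p
  have h1 : (fun q => inner ℝ (φ.toFun q) (φ.toFun q)) = fun _ : ℝ × ℝ => (1 : ℝ) := by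
    funext q
    simp [φ.norm_eq_one q]
  have h2 := fderiv_inner_apply ℝ hd hd (frame i)
  rw [h1] at h2
  simp only [fderiv_fun_const, Pi.zero_apply, zero_apply] at h2
  rw [real_inner_comm (φ.toFun p)] at h2
  change inner ℝ (φ.toFun p) (fderiv ℝ φ.toFun p (frame i)) = (0 : ℝ)
  rw [real_inner_comm] at h2 ⊢
  linarith

theorem isSection_roughLaplacian (hV : IsSection φ V) : IsSection φ (roughLaplacian φ V) :=
  (IsSection.sum fun i => isSection_nabla (isSection_nabla hV.1 i).1 i).neg

theorem isSection_tension : IsSection φ (tension φ) :=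
  IsSection.sum fun i => isSection_nabla (isSection_dmap i).1 i

theorem smoothOnTorus_normSqD : SmoothOnTorus (normSqD φ) := by
  have h := SmoothOnTorus.sum fun i =>
    (isSection_dmap (φ := φ) i).1.inner (isSection_dmap (φ := φ) i).1
  simp only [real_inner_self_eq_norm_sq] at h
  exact h

theorem isSection_traceD (hV : IsSection φ V) : IsSection φ (traceD φ V) :=
  IsSection.sum fun i => IsSection.smul (hV.1.inner (isSection_dmap i).1) (isSection_dmap i)

theorem smoothOnTorus_pairingD (hV : IsSection φ V) : SmoothOnTorus (pairingD φ V) :=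
  SmoothOnTorus.sum fun i => (isSection_nabla hV.1 i).1.inner (isSection_dmap i).1

theorem isSection_secondVariation (hV : IsSection φ V) : IsSection φ (secondVariation φ V) := by
  have c2 : SmoothOnTorus (fun _ : ℝ × ℝ => (2 : ℝ)) := SmoothOnTorus.const 2
  have ht : IsSection φ (tension φ) := isSection_tension
  have hN : SmoothOnTorus (normSqD φ) := smoothOnTorus_normSqD
  have hL := isSection_roughLaplacian hV
  have hT := isSection_traceD hV
  have htt : SmoothOnTorus (fun p => ‖tension φ p‖ ^ 2) := by
    simpa using ht.1.inner ht.1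
  have hNN : SmoothOnTorus (fun p => normSqD φ p ^ 2) := by
    simpa [pow_two] using SmoothOnTorus.smul hN hN
  have h2 : ∀ {c : ℝ × ℝ → ℝ}, SmoothOnTorus c → SmoothOnTorus (fun p => 2 * c p) :=
    fun hc => by simpa using c2.smul hc
  exact ((((((((((((isSection_roughLaplacian hL).add
    (isSection_roughLaplacian (hT.sub (IsSection.smul hN hV)))).add
    (IsSection.smul (h2 (smoothOnTorus_pairingD ht)) hV)).add
    (IsSection.smul htt hV)).sub
    (IsSection.const_smul 2 (IsSection.sum fun i =>
      IsSection.smul (hV.1.inner (isSection_nabla ht.1 i).1) (isSection_dmap i)))).sub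
    (IsSection.const_smul 2 (IsSection.sum fun i =>
      IsSection.smul (ht.1.inner (isSection_nabla hV.1 i).1) (isSection_dmap i)))).sub
    (IsSection.smul (ht.1.inner hV.1) ht)).add
    (isSection_traceD hL)).add
    (isSection_traceD hT)).sub
    (IsSection.smul (h2 hN) hT)).add
    (IsSection.smul (h2 (smoothOnTorus_pairingD hV)) ht)).sub
    (IsSection.smul hN hL)).add
    (IsSection.smul hNN hV)

theorem nabla_add (hV : SmoothOnTorus V) (hW : SmoothOnTorus W) (i : Fin 2) :
    nabla φ i (fun p => V p + W p) = fun p => nabla φ i V p + nabla φ i W p := by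
  funext p
  simp only [nabla, partialD_add hV hW, inner_add_right]
  module

theorem nabla_const_smul (hV : SmoothOnTorus V) (c : ℝ) (i : Fin 2) :
    nabla φ i (fun p => c • V p) = fun p => c • nabla φ i V p := by
  funext p
  simp only [nabla, partialD_const_smul hV, inner_smul_right]
  module

theorem roughLaplacian_add (hV : IsSection φ V) (hW : IsSection φ W) :
    roughLaplacian φ (fun p => V p + W p)
      = fun p => roughLaplacian φ V p + roughLaplacian φ W p := by
  funext p
  simp only [roughLaplacian, nabla_add hV.1 hW.1,
    nabla_add (isSection_nabla (φ := φ) hV.1 _).1 (isSection_nabla (φ := φ) hW.1 _).1,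
    Fin.sum_univ_two]
  module

theorem roughLaplacian_const_smul (hV : IsSection φ V) (c : ℝ) :
    roughLaplacian φ (fun p => c • V p) = fun p => c • roughLaplacian φ V p := by
  funext p
  simp only [roughLaplacian, nabla_const_smul hV.1,
    nabla_const_smul (isSection_nabla (φ := φ) hV.1 _).1, Fin.sum_univ_two]
  module

theorem traceD_add (V W : ℝ × ℝ → E3) :
    traceD φ (fun p => V p + W p) = fun p => traceD φ V p + traceD φ W p := by
  funext p
  simp only [traceD, Fin.sum_univ_two, inner_add_left]
  module

theorem traceD_const_smul (V : ℝ × ℝ → E3) (c : ℝ) :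
    traceD φ (fun p => c • V p) = fun p => c • traceD φ V p := by
  funext p
  simp only [traceD, Fin.sum_univ_two, real_inner_smul_left]
  module

theorem pairingD_add (hV : IsSection φ V) (hW : IsSection φ W) :
    pairingD φ (fun p => V p + W p) = fun p => pairingD φ V p + pairingD φ W p := by
  funext p
  simp only [pairingD, Fin.sum_univ_two, nabla_add hV.1 hW.1, inner_add_left]
  ring

theorem pairingD_const_smul (hV : IsSection φ V) (c : ℝ) :
    pairingD φ (fun p => c • V p) = fun p => c * pairingD φ V p := by
  funext p
  simp only [pairingD, Fin.sum_univ_two, nabla_const_smul hV.1, real_inner_smul_left]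
  ring

theorem secondVariation_add (hV : IsSection φ V) (hW : IsSection φ W) :
    secondVariation φ (fun p => V p + W p)
      = fun p => secondVariation φ V p + secondVariation φ W p := by
  funext p
  have hA := (isSection_traceD hV).sub (IsSection.smul (smoothOnTorus_normSqD (φ := φ)) hV)
  have hB := (isSection_traceD hW).sub (IsSection.smul (smoothOnTorus_normSqD (φ := φ)) hW)
  have e : (fun q => traceD φ V q + traceD φ W q - normSqD φ q • (V q + W q))
      = fun q => (traceD φ V q - normSqD φ q • V q) + (traceD φ W q - normSqD φ q • W q) := by
    funext q
    module
  simp only [secondVariation, roughLaplacian_add hV hW, traceD_add, e, roughLaplacian_add hA hB,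
    roughLaplacian_add (isSection_roughLaplacian hV) (isSection_roughLaplacian hW),
    pairingD_add hV hW, nabla_add hV.1 hW.1, inner_add_left, inner_add_right, Fin.sum_univ_two]
  module

theorem secondVariation_const_smul (hV : IsSection φ V) (c : ℝ) :
    secondVariation φ (fun p => c • V p) = fun p => c • secondVariation φ V p := by
  funext p
  have hA := (isSection_traceD hV).sub (IsSection.smul (smoothOnTorus_normSqD (φ := φ)) hV)
  have e : (fun q => c • traceD φ V q - normSqD φ q • c • V q)
      = fun q => c • (traceD φ V q - normSqD φ q • V q) := by
    funext q
    module
  simp only [secondVariation, roughLaplacian_const_smul hV, traceD_const_smul, e,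
    roughLaplacian_const_smul hA, roughLaplacian_const_smul (isSection_roughLaplacian hV),
    pairingD_const_smul hV, nabla_const_smul hV.1, real_inner_smul_left, real_inner_smul_right,
    Fin.sum_univ_two]
  module

end Facts

/-- The real vector space `C(φ⁻¹ T S²)` of smooth sections of `φ⁻¹ T S²`. -/
def sections (φ : SphereMap) : Submodule ℝ (ℝ × ℝ → E3) where
  carrier := {V | IsSection φ V}
  add_mem' hV hW := IsSection.add hV hW
  zero_mem' := ⟨SmoothOnTorus.const 0, fun p => by simp⟩
  smul_mem' c _ hV := IsSection.const_smul c hV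

/-- The second variation operator `I₂ : C(φ⁻¹ T S²) → C(φ⁻¹ T S²)`. -/
def I₂ (φ : SphereMap) : Module.End ℝ (sections φ) where
  toFun V := ⟨secondVariation φ V.1, isSection_secondVariation V.2⟩
  map_add' V W := Subtype.ext (secondVariation_add V.2 W.2)
  map_smul' c V := Subtype.ext (secondVariation_const_smul V.2 c)

/-! ### The map `φ_k` and the list of eigenvalues -/

/-- The map `(γ, ϑ) ↦ (sin(π/4) cos kγ, sin(π/4) sin kγ, cos(π/4))`. -/
def phi (k : ℕ) : SphereMap where
  toFun p := !₂[sin (π / 4) * cos (k * p.1), sin (π / 4) * sin (k * p.1), cos (π / 4)]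
  smoothOnTorus := by
    refine ⟨?_, fun a b => ?_, fun a b => rfl⟩
    · rw [contDiff_euclidean]
      intro i
      fin_cases i <;> simp <;> fun_prop
    · have h : (k : ℝ) * (a + 2 * π) = k * a + k * (2 * π) := by ring
      simp only [h, cos_add_nat_mul_two_pi, sin_add_nat_mul_two_pi]
  norm_eq_one p := by
    rw [EuclideanSpace.norm_eq, Real.sqrt_eq_one]
    simp only [Fin.sum_univ_three, Real.norm_eq_abs, sq_abs]
    simp only [Matrix.cons_val_zero, Matrix.cons_val_one, Matrix.cons_val]
    have h1 := sin_sq_add_cos_sq (k * p.1)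
    have h2 := sin_sq_add_cos_sq (π / 4)
    linear_combination (sin (π / 4)) ^ 2 * h1 + h2

/-- The entries of the list of eigenvalues: `μ₀`, `μ₁`, and `λ⁺_{m,n}`, `λ⁻_{m,n}` for all
`(m, n) ∈ ℕ × ℕ` other than `(0, 0)`. -/
inductive SpectralIndex : Type
  | mu0 : SpectralIndex
  | mu1 : SpectralIndex
  | lamPlus (m n : ℕ) (h : (m, n) ≠ (0, 0)) : SpectralIndex
  | lamMinus (m n : ℕ) (h : (m, n) ≠ (0, 0)) : SpectralIndex

/-- `λ⁺_{m,n}`, in the three cases `n = 0`, `m = 0`, and `m, n ≥ 1`. -/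
def lambdaPlus (k m n : ℕ) : ℝ :=
  if n = 0 then
    1 / 2 * (-(k : ℝ) ^ 4 + 5 * k ^ 2 * m ^ 2 + 2 * m ^ 4
      + √((k : ℝ) ^ 8 + 2 * k ^ 6 * m ^ 2 + k ^ 4 * m ^ 4 + 32 * k ^ 2 * m ^ 6))
  else if m = 0 then
    (n : ℝ) ^ 2 * ((n : ℝ) ^ 2 + k ^ 2)
  else
    1 / 2 * (-(k : ℝ) ^ 4 + k ^ 2 * (5 * m ^ 2 + n ^ 2) + 2 * ((m : ℝ) ^ 2 + n ^ 2) ^ 2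
      + √((k : ℝ) ^ 8 + 2 * k ^ 6 * (m ^ 2 + n ^ 2) + k ^ 4 * ((m : ℝ) ^ 2 + n ^ 2) ^ 2
          + 32 * k ^ 2 * m ^ 2 * ((m : ℝ) ^ 2 + n ^ 2) ^ 2))

/-- `λ⁻_{m,n}`, in the three cases `n = 0`, `m = 0`, and `m, n ≥ 1`. -/
def lambdaMinus (k m n : ℕ) : ℝ :=
  if n = 0 then
    1 / 2 * (-(k : ℝ) ^ 4 + 5 * k ^ 2 * m ^ 2 + 2 * m ^ 4
      - √((k : ℝ) ^ 8 + 2 * k ^ 6 * m ^ 2 + k ^ 4 * m ^ 4 + 32 * k ^ 2 * m ^ 6))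
  else if m = 0 then
    (n : ℝ) ^ 4 - (k : ℝ) ^ 4
  else
    1 / 2 * (-(k : ℝ) ^ 4 + k ^ 2 * (5 * m ^ 2 + n ^ 2) + 2 * ((m : ℝ) ^ 2 + n ^ 2) ^ 2
      - √((k : ℝ) ^ 8 + 2 * k ^ 6 * (m ^ 2 + n ^ 2) + k ^ 4 * ((m : ℝ) ^ 2 + n ^ 2) ^ 2
          + 32 * k ^ 2 * m ^ 2 * ((m : ℝ) ^ 2 + n ^ 2) ^ 2))

/-- The value of an entry of the list. -/
def SpectralIndex.value (k : ℕ) : SpectralIndex → ℝ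
  | .mu0 => 0
  | .mu1 => -(k : ℝ) ^ 4
  | .lamPlus m n _ => lambdaPlus k m n
  | .lamMinus m n _ => lambdaMinus k m n

/-- The multiplicity `ν` of an entry of the list. -/
def SpectralIndex.mult : SpectralIndex → ℕ
  | .mu0 => 1
  | .mu1 => 1
  | .lamPlus m n _ => if m = 0 ∨ n = 0 then 2 else 4
  | .lamMinus m n _ => if m = 0 ∨ n = 0 then 2 else 4

/-- The standard `L²` inner product of sections, `∫_{𝕋²} ⟨V, W⟩ dγ dϑ`. -/
def innerL2 {φ : SphereMap} (V W : sections φ) : ℝ :=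
  ∫ p in Set.Icc (0 : ℝ) (2 * π) ×ˢ Set.Icc (0 : ℝ) (2 * π), inner ℝ (V.1 p) (W.1 p)

end BiharmonicTorus

end

noncomputable section

namespace BiharmonicTorus

open MeasureTheory

/-! ### Differentiation rules on the torus. -/

section Calculus

variable {F : Type*} [NormedAddCommGroup F] [NormedSpace ℝ F]

/-! Along `phi k` the unit tangent `X` of the image circle and its unit normal `N` in the sphere
form a global orthonormal frame of the pull-back bundle. It is parallel in `ϑ` and rotates at the
constant rate `speed k = k/√2` in `γ`, so `I₂` has constant coefficients in this frame.

Let `e_j` be the normalized cosines (`j ≥ 0`) and sines (`j < 0`). Both `∂/∂γ` and the rotation of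
the frame exchange two things: the first `e_i` with `e_{-i}`, the second `X` with `N`. Hence the
plane spanned by `e_i(γ) e_j(ϑ) X` and `e_{-i}(γ) e_j(ϑ) N` is invariant under `I₂`, which acts on
it by a symmetric 2 × 2 matrix (`secondVariation_mode`). Its two eigenvalues are the entries of the
list at `m = |i|`, `n = |j|`, and the multiplicities 1, 2, 4 count the sign choices of `i` and `j`
(`card_fiber_toIndex`).

The eigensections obtained in this way are orthonormal, and they are dense because trigonometric
polynomials approximate smooth functions on the torus uniformly (`SmoothOnTorus.exists_trigPoly`).

No other eigensections exist: `I₂` is `L²`-symmetric (`pairL2_secondVariation`, by integration by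
parts for an arbitrary map into the sphere), so an eigensection for `μ` is orthogonal to every
family member with another eigenvalue. Since the eigenvalues grow quartically (`le_modeEigenvalue`),
only finitely many members have eigenvalue `μ`, and by density they span the eigenspace
(`eigenspace_eq_span`). -/

theorem partialD_smul {c : ℝ × ℝ → ℝ} {f : ℝ × ℝ → F} (hc : SmoothOnTorus c)
    (hf : SmoothOnTorus f) (i : Fin 2) (p : ℝ × ℝ) :
    partialD i (fun q => c q • f q) p = c p • partialD i f p + partialD i c p • f p := by
  have h1 := (hc.smooth.differentiable (by simp)) p
  have h2 := (hf.smooth.differentiable (by simp)) p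
  simp [partialD, fderiv_fun_smul h1 h2]

theorem partialD_mul {f g : ℝ × ℝ → ℝ} (hf : SmoothOnTorus f) (hg : SmoothOnTorus g) (i : Fin 2)
    (p : ℝ × ℝ) : partialD i (fun q => f q * g q) p = f p * partialD i g p + partialD i f p * g p :=
  by simpa using partialD_smul hf hg i p

theorem partialD_inner {V W : ℝ × ℝ → E3} (hV : SmoothOnTorus V) (hW : SmoothOnTorus W)
    (i : Fin 2) (p : ℝ × ℝ) :
    partialD i (fun q => inner ℝ (V q) (W q)) p
      = inner ℝ (V p) (partialD i W p) + inner ℝ (partialD i V p) (W p) :=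
  fderiv_inner_apply ℝ (hV.smooth.differentiable (by simp) p)
    (hW.smooth.differentiable (by simp) p) (frame i)

@[simp]
theorem partialD_const (c : F) (i : Fin 2) (p : ℝ × ℝ) : partialD i (fun _ => c) p = 0 := by
  simp [partialD]

theorem partialD_zero_eq_of_hasDerivAt {u : ℝ → F} {u' : F} {p : ℝ × ℝ}
    (h : HasDerivAt u u' p.1) : partialD 0 (fun q => u q.1) p = u' := by
  have := (h.hasFDerivAt.comp p (hasFDerivAt_fst (p := p))).fderiv
  simp only [partialD]
  rw [show (fun q : ℝ × ℝ => u q.1) = u ∘ Prod.fst from rfl, this]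
  simp [frame]

theorem partialD_one_eq_of_hasDerivAt {u : ℝ → F} {u' : F} {p : ℝ × ℝ}
    (h : HasDerivAt u u' p.2) : partialD 1 (fun q => u q.2) p = u' := by
  have := (h.hasFDerivAt.comp p (hasFDerivAt_snd (p := p))).fderiv
  simp only [partialD]
  rw [show (fun q : ℝ × ℝ => u q.2) = u ∘ Prod.snd from rfl, this]
  simp [frame]

theorem partialD_one_comp_fst {u : ℝ → F} {u' : F} {p : ℝ × ℝ}
    (h : HasDerivAt u u' p.1) : partialD 1 (fun q => u q.1) p = 0 := by
  have := (h.hasFDerivAt.comp p (hasFDerivAt_fst (p := p))).fderiv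
  simp only [partialD]
  rw [show (fun q : ℝ × ℝ => u q.1) = u ∘ Prod.fst from rfl, this]
  simp [frame]

theorem partialD_zero_comp_snd {u : ℝ → F} {u' : F} {p : ℝ × ℝ}
    (h : HasDerivAt u u' p.2) : partialD 0 (fun q => u q.2) p = 0 := by
  have := (h.hasFDerivAt.comp p (hasFDerivAt_snd (p := p))).fderiv
  simp only [partialD]
  rw [show (fun q : ℝ × ℝ => u q.2) = u ∘ Prod.snd from rfl, this]
  simp [frame]

end Calculus

/-! ### An orthonormal frame along `φ_k` -/

/-- The unit radial field `(cos kγ, sin kγ, 0)`. -/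
def radial (k : ℕ) (p : ℝ × ℝ) : E3 := !₂[cos (k * p.1), sin (k * p.1), 0]

/-- The unit field `(-sin kγ, cos kγ, 0)`, tangent to the image circle of `φ_k`. -/
def tangentField (k : ℕ) (p : ℝ × ℝ) : E3 := !₂[-sin (k * p.1), cos (k * p.1), 0]

/-- The unit field normal to the image circle of `φ_k` in `S²`. -/
def normalField (k : ℕ) (p : ℝ × ℝ) : E3 :=
  !₂[√2 / 2 * cos (k * p.1), √2 / 2 * sin (k * p.1), -(√2 / 2)]

theorem half_sqrt_two_sq : (√2 / 2) ^ 2 = 1 / 2 := by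
  rw [div_pow, Real.sq_sqrt (by norm_num)]; norm_num

/-- The derivative of `tangentField` is radial; this splitting isolates the part normal to the
sphere, which the connection discards. -/
theorem radial_eq (k : ℕ) (p : ℝ × ℝ) :
    radial k p = (√2 / 2) • (phi k).toFun p + (√2 / 2) • normalField k p := by
  have h := half_sqrt_two_sq
  ext i
  fin_cases i <;> simp [radial, phi, normalField]
  · linear_combination (-2 * cos (k * p.1)) * h
  · linear_combination (-2 * sin (k * p.1)) * h

section Inner

variable (k : ℕ) (p : ℝ × ℝ)

theorem inner_tangent_tangent : inner ℝ (tangentField k p) (tangentField k p) = (1 : ℝ) := by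
  rw [real_inner_self_eq_norm_sq, EuclideanSpace.real_norm_sq_eq]
  simp [tangentField, Fin.sum_univ_three]

theorem inner_normal_normal : inner ℝ (normalField k p) (normalField k p) = (1 : ℝ) := by
  rw [real_inner_self_eq_norm_sq, EuclideanSpace.real_norm_sq_eq]
  simp only [normalField, Fin.sum_univ_three, Matrix.cons_val_zero, Matrix.cons_val_one,
    Matrix.cons_val]
  linear_combination (√2 / 2) ^ 2 * sin_sq_add_cos_sq (k * p.1) + 2 * half_sqrt_two_sq

theorem inner_tangent_normal : inner ℝ (tangentField k p) (normalField k p) = (0 : ℝ) := by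
  simp [tangentField, normalField, PiLp.inner_apply, Fin.sum_univ_three]
  ring

theorem inner_normal_tangent : inner ℝ (normalField k p) (tangentField k p) = (0 : ℝ) := by
  rw [real_inner_comm, inner_tangent_normal]

theorem inner_phi_tangent : inner ℝ ((phi k).toFun p) (tangentField k p) = (0 : ℝ) := by
  simp [phi, tangentField, PiLp.inner_apply, Fin.sum_univ_three]
  ring

theorem inner_phi_normal : inner ℝ ((phi k).toFun p) (normalField k p) = (0 : ℝ) := by
  simp [phi, normalField, PiLp.inner_apply, Fin.sum_univ_three]
  linear_combination (√2 / 2) ^ 2 * sin_sq_add_cos_sq (k * p.1)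

theorem inner_phi_phi : inner ℝ ((phi k).toFun p) ((phi k).toFun p) = (1 : ℝ) := by
  simp [(phi k).norm_eq_one]

end Inner

theorem smoothOnTorus_tangentField (k : ℕ) : SmoothOnTorus (tangentField k) := by
  refine ⟨?_, fun a b => ?_, fun a b => rfl⟩
  · rw [contDiff_euclidean]
    intro i
    fin_cases i <;> simp [tangentField] <;> fun_prop
  · have h : (k : ℝ) * (a + 2 * π) = k * a + k * (2 * π) := by ring
    simp only [tangentField, h, cos_add_nat_mul_two_pi, sin_add_nat_mul_two_pi]

theorem smoothOnTorus_normalField (k : ℕ) : SmoothOnTorus (normalField k) := by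
  refine ⟨?_, fun a b => ?_, fun a b => rfl⟩
  · rw [contDiff_euclidean]
    intro i
    fin_cases i <;> simp [normalField] <;> fun_prop
  · have h : (k : ℝ) * (a + 2 * π) = k * a + k * (2 * π) := by ring
    simp only [normalField, h, cos_add_nat_mul_two_pi, sin_add_nat_mul_two_pi]

/-- The map and both frame fields have this shape, so one derivative serves all three. -/
theorem hasDerivAt_circle (k : ℕ) (v w z : E3) (t : ℝ) :
    HasDerivAt (fun t : ℝ => cos (k * t) • v + sin (k * t) • w + z)
      (-(k * sin (k * t)) • v + (k * cos (k * t)) • w) t := by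
  have h0 : HasDerivAt (fun t : ℝ => (k : ℝ) * t) k t := by
    simpa using (hasDerivAt_id t).const_mul (k : ℝ)
  have h1 := (h0.cos.smul_const v).add (h0.sin.smul_const w)
  refine (h1.add_const z).congr_deriv ?_
  module

theorem partialD_circle {k : ℕ} {f : ℝ × ℝ → E3} (v w z : E3)
    (hf : ∀ p, f p = cos (k * p.1) • v + sin (k * p.1) • w + z) (p : ℝ × ℝ) :
    partialD 0 f p = -(k * sin (k * p.1)) • v + (k * cos (k * p.1)) • w ∧ partialD 1 f p = 0 := by
  obtain rfl : f = fun p => cos (k * p.1) • v + sin (k * p.1) • w + z := funext hf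
  exact ⟨partialD_zero_eq_of_hasDerivAt (hasDerivAt_circle k v w z p.1),
    partialD_one_comp_fst (hasDerivAt_circle k v w z p.1)⟩

theorem partialD_tangentField (k : ℕ) (p : ℝ × ℝ) :
    partialD 0 (tangentField k) p = -(k : ℝ) • radial k p ∧ partialD 1 (tangentField k) p = 0 := by
  obtain ⟨h0, h1⟩ := partialD_circle (f := tangentField k) (k := k) !₂[0, 1, 0] !₂[-1, 0, 0] 0
    (fun q => by ext i; fin_cases i <;> simp [tangentField]) p
  refine ⟨h0.trans ?_, h1⟩
  ext i; fin_cases i <;> simp [radial]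

theorem partialD_normalField (k : ℕ) (p : ℝ × ℝ) :
    partialD 0 (normalField k) p = (k * (√2 / 2)) • tangentField k p
      ∧ partialD 1 (normalField k) p = 0 := by
  obtain ⟨h0, h1⟩ := partialD_circle (f := normalField k) (k := k) !₂[√2 / 2, 0, 0]
    !₂[0, √2 / 2, 0] !₂[0, 0, -(√2 / 2)]
    (fun q => by ext i; fin_cases i <;> simp [normalField, mul_comm]) p
  refine ⟨h0.trans ?_, h1⟩
  ext i; fin_cases i <;> simp [tangentField] <;> ring

/-- The speed `k / √2` of the image circle of `φ_k`. -/
def speed (k : ℕ) : ℝ := k * (√2 / 2)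

theorem speed_sq (k : ℕ) : speed k ^ 2 = k ^ 2 / 2 := by
  rw [speed, mul_pow, half_sqrt_two_sq]; ring

theorem dmap_phi_zero (k : ℕ) : dmap (phi k) 0 = fun p => speed k • tangentField k p := by
  funext p
  obtain ⟨h0, -⟩ := partialD_circle (f := (phi k).toFun) (k := k) !₂[√2 / 2, 0, 0]
    !₂[0, √2 / 2, 0] !₂[0, 0, √2 / 2]
    (fun q => by ext i; fin_cases i <;> simp [phi, mul_comm]) p
  refine h0.trans ?_
  ext i; fin_cases i <;> simp [tangentField, speed] <;> ring

theorem dmap_phi_one (k : ℕ) : dmap (phi k) 1 = fun _ => 0 := by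
  funext p
  exact (partialD_circle (f := (phi k).toFun) (k := k) !₂[√2 / 2, 0, 0]
    !₂[0, √2 / 2, 0] !₂[0, 0, √2 / 2]
    (fun q => by ext i; fin_cases i <;> simp [phi, mul_comm]) p).2

/-- The field `f X + g N` along `φ_k`. -/
def frameField (k : ℕ) (f g : ℝ × ℝ → ℝ) : ℝ × ℝ → E3 :=
  fun p => f p • tangentField k p + g p • normalField k p

section FrameField

variable {k : ℕ} {f g f' g' : ℝ × ℝ → ℝ}

theorem isSection_frameField (hf : SmoothOnTorus f) (hg : SmoothOnTorus g) :
    IsSection (phi k) (frameField k f g) :=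
  ⟨(hf.smul (smoothOnTorus_tangentField k)).add (hg.smul (smoothOnTorus_normalField k)), fun p => by
    simp [frameField, inner_add_right, inner_smul_right, inner_phi_tangent, inner_phi_normal]⟩

theorem inner_frameField (p : ℝ × ℝ) :
    inner ℝ (frameField k f g p) (frameField k f' g' p) = f p * f' p + g p * g' p := by
  simp only [frameField, inner_add_left, inner_add_right, real_inner_smul_left,
    real_inner_smul_right, inner_tangent_tangent, inner_normal_normal, inner_tangent_normal,
    inner_normal_tangent]
  ring

theorem partialD_frameField (hf : SmoothOnTorus f) (hg : SmoothOnTorus g) (i : Fin 2)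
    (p : ℝ × ℝ) : partialD i (frameField k f g) p
      = partialD i f p • tangentField k p + f p • partialD i (tangentField k) p
        + (partialD i g p • normalField k p + g p • partialD i (normalField k) p) := by
  unfold frameField
  rw [partialD_add (hf.smul (smoothOnTorus_tangentField k)) (hg.smul (smoothOnTorus_normalField k)),
    partialD_smul hf (smoothOnTorus_tangentField k), partialD_smul hg (smoothOnTorus_normalField k)]
  module

/-- The frame rotates: `∇₀X = -speed • N` and `∇₀N = speed • X`. -/
theorem nabla_zero_frameField (hf : SmoothOnTorus f) (hg : SmoothOnTorus g) :
    nabla (phi k) 0 (frameField k f g) = frameField k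
      (fun p => partialD 0 f p + speed k * g p) (fun p => partialD 0 g p - speed k * f p) := by
  funext p
  simp only [nabla, partialD_frameField hf hg, partialD_tangentField, partialD_normalField,
    radial_eq, inner_add_right, real_inner_smul_right, inner_phi_tangent, inner_phi_normal,
    inner_phi_phi, frameField, speed]
  module

theorem nabla_one_frameField (hf : SmoothOnTorus f) (hg : SmoothOnTorus g) :
    nabla (phi k) 1 (frameField k f g) = frameField k (partialD 1 f) (partialD 1 g) := by
  funext p
  simp only [nabla, partialD_frameField hf hg, partialD_tangentField, partialD_normalField,
    inner_add_right, real_inner_smul_right, inner_phi_tangent, inner_phi_normal,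
    frameField, smul_zero, add_zero]
  module

/-- A tangent field is the combination of the frame given by its inner products with it. -/
theorem frameField_inner {V : ℝ × ℝ → E3} (hV : IsSection (phi k) V) :
    frameField k (fun p => inner ℝ (tangentField k p) (V p))
      (fun p => inner ℝ (normalField k p) (V p)) = V := by
  funext p
  have hs := half_sqrt_two_sq
  have h := hV.2 p
  have h1 := sin_sq_add_cos_sq (k * p.1)
  simp only [phi, PiLp.inner_apply, Fin.sum_univ_three, sin_pi_div_four, cos_pi_div_four] at h
  simp at h
  have hpos : (√2 / 2 : ℝ) ≠ 0 := by positivity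
  -- Orthogonality to `φ`, divided by `√2/2`, determines the third coordinate.
  have h2 : V p 2 = -(cos (k * p.1) * V p 0 + sin (k * p.1) * V p 1) := by
    apply mul_left_cancel₀ hpos
    linear_combination h
  ext i
  fin_cases i <;>
    simp [frameField, tangentField, normalField, PiLp.inner_apply, Fin.sum_univ_three, h2]
  · linear_combination V p 0 * h1 +
      2 * cos (k * p.1) * (cos (k * p.1) * V p 0 + sin (k * p.1) * V p 1) * hs
  · linear_combination V p 1 * h1 +
      2 * sin (k * p.1) * (cos (k * p.1) * V p 0 + sin (k * p.1) * V p 1) * hs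
  · linear_combination
      -2 * (cos (k * p.1) * V p 0 + sin (k * p.1) * V p 1) * hs

end FrameField

theorem frameField_const (k : ℕ) (A B : ℝ) (p : ℝ × ℝ) :
    frameField k (fun _ => A) (fun _ => B) p = A • tangentField k p + B • normalField k p := rfl

theorem tension_phi (k : ℕ) :
    tension (phi k) = frameField k (fun _ => 0) (fun _ => -speed k ^ 2) := by
  have h0 : dmap (phi k) 0 = frameField k (fun _ => speed k) (fun _ => 0) := by
    rw [dmap_phi_zero]; funext p; simp [frameField]
  have h1 : dmap (phi k) 1 = frameField k (fun _ => 0) (fun _ => 0) := by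
    rw [dmap_phi_one]; funext p; simp [frameField]
  funext p
  rw [tension, Fin.sum_univ_two, h0, h1,
    nabla_zero_frameField (SmoothOnTorus.const _) (SmoothOnTorus.const _),
    nabla_one_frameField (SmoothOnTorus.const _) (SmoothOnTorus.const _)]
  simp only [frameField, partialD_const]
  module

theorem tension_phi_apply (k : ℕ) (p : ℝ × ℝ) :
    tension (phi k) p = (-speed k ^ 2) • normalField k p := by
  rw [tension_phi, frameField_const]
  module

theorem nabla_zero_tension_phi (k : ℕ) (p : ℝ × ℝ) :
    nabla (phi k) 0 (tension (phi k)) p = -speed k ^ 3 • tangentField k p := by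
  rw [tension_phi, nabla_zero_frameField (SmoothOnTorus.const _) (SmoothOnTorus.const _)]
  simp only [frameField, partialD_const]
  module

theorem nabla_one_tension_phi (k : ℕ) (p : ℝ × ℝ) :
    nabla (phi k) 1 (tension (phi k)) p = 0 := by
  rw [tension_phi, nabla_one_frameField (SmoothOnTorus.const _) (SmoothOnTorus.const _)]
  simp only [frameField, partialD_const]
  module

theorem normSqD_phi (k : ℕ) (p : ℝ × ℝ) : normSqD (phi k) p = speed k ^ 2 := by
  rw [normSqD, Fin.sum_univ_two, dmap_phi_zero, dmap_phi_one]
  simp only [← real_inner_self_eq_norm_sq, real_inner_smul_left, real_inner_smul_right,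
    inner_tangent_tangent, inner_zero_left]
  ring

theorem traceD_frameField (k : ℕ) (f g : ℝ × ℝ → ℝ) (p : ℝ × ℝ) :
    traceD (phi k) (frameField k f g) p = (speed k ^ 2 * f p) • tangentField k p := by
  rw [traceD, Fin.sum_univ_two, dmap_phi_zero, dmap_phi_one]
  simp only [frameField, inner_add_left, real_inner_smul_left, real_inner_smul_right,
    inner_tangent_tangent, inner_normal_tangent]
  module

/-! ### Trigonometric modes -/

/-- The trigonometric functions `cos jx` (`j > 0`), `1` (`j = 0`), `sin |j|x` (`j < 0`), normalized
in `L²(0, 2π)`. -/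
def trig (j : ℤ) (x : ℝ) : ℝ :=
  (if j = 0 then √(2 * π) else √π)⁻¹ * (if 0 ≤ j then cos (j * x) else sin (-(j * x)))

/-- Indexing sines by negative integers gives cosines, sines and the constant a single derivative
formula. -/
theorem hasDerivAt_trig (j : ℤ) (x : ℝ) : HasDerivAt (trig j) (-j * trig (-j) x) x := by
  have h0 : HasDerivAt (fun t : ℝ => (j : ℝ) * t) j x := by
    simpa using (hasDerivAt_id x).const_mul (j : ℝ)
  rcases lt_trichotomy j 0 with h | rfl | h
  · have h2 := (h0.neg.sin.const_mul ((√π)⁻¹))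
    have e : trig j = fun t => (√π)⁻¹ * sin (-(j * t)) := by
      funext t; simp [trig, h.ne, not_le.2 h]
    rw [e]
    refine h2.congr_deriv ?_
    simp [trig, h.ne, h.le]
    ring
  · have e : trig 0 = fun t => (√(2 * π))⁻¹ := by funext t; simp [trig]
    rw [e]
    simpa using hasDerivAt_const x (√(2 * π))⁻¹
  · have h2 := (h0.cos.const_mul ((√π)⁻¹))
    have e : trig j = fun t => (√π)⁻¹ * cos (j * t) := by
      funext t; simp [trig, h.ne', h.le]
    rw [e]
    refine h2.congr_deriv ?_
    simp [trig, h.ne', not_le.2 h]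
    ring

theorem contDiff_trig (j : ℤ) : ContDiff ℝ ∞ (trig j) := by
  unfold trig
  split_ifs <;> fun_prop

theorem trig_add_two_pi (j : ℤ) (x : ℝ) : trig j (x + 2 * π) = trig j x := by
  have h1 : (j : ℝ) * (x + 2 * π) = j * x + j * (2 * π) := by ring
  have h2 : -(j * x + j * (2 * π)) = -(j * x) - j * (2 * π) := by ring
  unfold trig
  rw [h1, h2, cos_add_int_mul_two_pi, sin_sub_int_mul_two_pi]

/-- The products `e_i(γ) e_j(ϑ)` of trigonometric functions. -/
def trig₂ (i j : ℤ) (p : ℝ × ℝ) : ℝ := trig i p.1 * trig j p.2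

theorem smoothOnTorus_trig_fst (i : ℤ) : SmoothOnTorus fun p => trig i p.1 :=
  ⟨(contDiff_trig i).comp contDiff_fst, fun _ _ => trig_add_two_pi i _, fun _ _ => rfl⟩

theorem smoothOnTorus_trig_snd (j : ℤ) : SmoothOnTorus fun p => trig j p.2 :=
  ⟨(contDiff_trig j).comp contDiff_snd, fun _ _ => rfl, fun _ _ => trig_add_two_pi j _⟩

theorem smoothOnTorus_trig₂ (i j : ℤ) : SmoothOnTorus (trig₂ i j) :=
  (smoothOnTorus_trig_fst i).smul (smoothOnTorus_trig_snd j)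

theorem smoothOnTorus_const_mul {f : ℝ × ℝ → ℝ} (c : ℝ) (hf : SmoothOnTorus f) :
    SmoothOnTorus fun p => c * f p :=
  (SmoothOnTorus.const c).smul hf

theorem partialD_zero_trig₂ (i j : ℤ) (p : ℝ × ℝ) :
    partialD 0 (trig₂ i j) p = -i * trig₂ (-i) j p := by
  refine (partialD_mul (smoothOnTorus_trig_fst i) (smoothOnTorus_trig_snd j) 0 p).trans ?_
  rw [partialD_zero_eq_of_hasDerivAt (hasDerivAt_trig i p.1),
    partialD_zero_comp_snd (hasDerivAt_trig j p.2)]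
  simp only [trig₂]
  ring

theorem partialD_one_trig₂ (i j : ℤ) (p : ℝ × ℝ) :
    partialD 1 (trig₂ i j) p = -j * trig₂ i (-j) p := by
  refine (partialD_mul (smoothOnTorus_trig_fst i) (smoothOnTorus_trig_snd j) 1 p).trans ?_
  rw [partialD_one_comp_fst (hasDerivAt_trig i p.1),
    partialD_one_eq_of_hasDerivAt (hasDerivAt_trig j p.2)]
  simp only [trig₂]
  ring

/-! ### Action of the connection and of `I₂` on a mode. -/

/-- The section `A e_i(γ) e_j(ϑ) X + B e_{-i}(γ) e_j(ϑ) N`. -/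
def mode (k : ℕ) (i j : ℤ) (A B : ℝ) : ℝ × ℝ → E3 :=
  frameField k (fun p => A * trig₂ i j p) (fun p => B * trig₂ (-i) j p)

theorem isSection_mode (k : ℕ) (i j : ℤ) (A B : ℝ) : IsSection (phi k) (mode k i j A B) :=
  isSection_frameField (smoothOnTorus_const_mul A (smoothOnTorus_trig₂ i j))
    (smoothOnTorus_const_mul B (smoothOnTorus_trig₂ (-i) j))

section Mode

variable (k : ℕ) (i j : ℤ) (A B : ℝ)

/-- This is why the normal component carries `-i`: differentiation and frame rotation both land in
the mode of index `-i`, and a second derivative returns to `i`. -/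
theorem nabla_zero_mode : nabla (phi k) 0 (mode k i j A B)
    = mode k (-i) j (speed k * B - i * A) (i * B - speed k * A) := by
  have h (c : ℝ) (i : ℤ) (p : ℝ × ℝ) :
      partialD 0 (fun q => c * trig₂ i j q) p = c * partialD 0 (trig₂ i j) p :=
    partialD_const_smul (smoothOnTorus_trig₂ i j) c 0 p
  unfold mode
  rw [nabla_zero_frameField (smoothOnTorus_const_mul A (smoothOnTorus_trig₂ i j))
    (smoothOnTorus_const_mul B (smoothOnTorus_trig₂ (-i) j))]
  simp only [h, partialD_zero_trig₂, neg_neg]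
  push_cast
  congr 1 <;> funext p <;> ring

theorem nabla_one_mode : nabla (phi k) 1 (mode k i j A B) = mode k i (-j) (-j * A) (-j * B) := by
  have h (c : ℝ) (i : ℤ) (p : ℝ × ℝ) :
      partialD 1 (fun q => c * trig₂ i j q) p = c * partialD 1 (trig₂ i j) p :=
    partialD_const_smul (smoothOnTorus_trig₂ i j) c 1 p
  unfold mode
  rw [nabla_one_frameField (smoothOnTorus_const_mul A (smoothOnTorus_trig₂ i j))
    (smoothOnTorus_const_mul B (smoothOnTorus_trig₂ (-i) j))]
  congr 1 <;> funext p <;> rw [h, partialD_one_trig₂] <;> ring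

theorem mode_apply (p : ℝ × ℝ) : mode k i j A B p
    = (A * trig₂ i j p) • tangentField k p + (B * trig₂ (-i) j p) • normalField k p := rfl

theorem roughLaplacian_mode : roughLaplacian (phi k) (mode k i j A B)
    = mode k i j ((i ^ 2 + j ^ 2 + speed k ^ 2) * A - 2 * speed k * i * B)
        ((i ^ 2 + j ^ 2 + speed k ^ 2) * B - 2 * speed k * i * A) := by
  funext p
  rw [roughLaplacian, Fin.sum_univ_two, nabla_zero_mode, nabla_zero_mode, nabla_one_mode,
    nabla_one_mode, neg_neg, neg_neg]
  simp only [mode_apply]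
  push_cast
  module

/-- `I₂` on a mode. -/
theorem secondVariation_mode : secondVariation (phi k) (mode k i j A B)
    = mode k i j
      (((i ^ 2 + j ^ 2) ^ 2 + k ^ 2 * (i ^ 2 + j ^ 2) + 2 * k ^ 2 * i ^ 2) * A
        - 4 * speed k * (i ^ 2 + j ^ 2) * i * B)
      (((i ^ 2 + j ^ 2) ^ 2 + 2 * k ^ 2 * i ^ 2 - k ^ 4) * B
        - 4 * speed k * (i ^ 2 + j ^ 2) * i * A) := by
  have hT (i j : ℤ) (A B : ℝ) (p : ℝ × ℝ) : traceD (phi k) (mode k i j A B) p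
      = (speed k ^ 2 * (A * trig₂ i j p)) • tangentField k p := traceD_frameField k _ _ p
  have hT' : traceD (phi k) (mode k i j A B) = mode k i j (speed k ^ 2 * A) 0 := by
    funext p
    rw [hT, mode_apply]
    module
  have hK : (fun q => traceD (phi k) (mode k i j A B) q - normSqD (phi k) q • mode k i j A B q)
      = mode k i j 0 (-speed k ^ 2 * B) := by
    funext p
    rw [hT, normSqD_phi, mode_apply, mode_apply]
    module
  -- With even powers of `k` expressed through `speed k`, the claim becomes a polynomial identity in
  -- `speed k`, `i`, `j`.
  have hk : (k : ℝ) ^ 2 = 2 * speed k ^ 2 := by rw [speed_sq]; ring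
  have hk4 : (k : ℝ) ^ 4 = 4 * speed k ^ 4 := by
    rw [show (k : ℝ) ^ 4 = (k ^ 2) ^ 2 by ring, hk]; ring
  rw [hk, hk4]
  funext p
  rw [secondVariation, hK]
  simp only [hT', hT, roughLaplacian_mode, pairingD, normSqD_phi,
    Fin.sum_univ_two, nabla_zero_tension_phi, nabla_one_tension_phi, nabla_zero_mode,
    dmap_phi_zero, dmap_phi_one, tension_phi_apply, ← real_inner_self_eq_norm_sq, mode_apply,
    inner_add_left, inner_add_right, real_inner_smul_left, real_inner_smul_right,
    inner_tangent_tangent, inner_normal_normal, inner_normal_tangent, inner_zero_right, smul_zero, neg_neg]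
  module

end Mode

/-! ### Integration over the torus. -/

/-- A fundamental domain of the torus. -/
def square : Set (ℝ × ℝ) := Set.Icc (0 : ℝ) (2 * π) ×ˢ Set.Icc (0 : ℝ) (2 * π)

theorem isCompact_square : IsCompact square := isCompact_Icc.prod isCompact_Icc

section Integrals

theorem integrableOn_square {u : ℝ × ℝ → ℝ} (hu : Continuous u) : IntegrableOn u square :=
  hu.continuousOn.integrableOn_compact isCompact_square

theorem SmoothOnTorus.integrableOn {u : ℝ × ℝ → ℝ} (hu : SmoothOnTorus u) :
    IntegrableOn u square :=
  integrableOn_square hu.smooth.continuous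

theorem setIntegral_Icc_deriv {u u' : ℝ → ℝ} {a b : ℝ} (hab : a ≤ b)
    (h : ∀ x, HasDerivAt u (u' x) x) (hu' : Continuous u') :
    ∫ x in Set.Icc a b, u' x = u b - u a := by
  rw [integral_Icc_eq_integral_Ioc, ← intervalIntegral.integral_of_le hab]
  exact intervalIntegral.integral_eq_sub_of_hasDerivAt (fun x _ => h x)
    (hu'.intervalIntegrable _ _)

/-- The integral over the torus of a derivative vanishes. -/
theorem integral_partialD {u : ℝ × ℝ → ℝ} (hu : SmoothOnTorus u) (i : Fin 2) :
    ∫ p in square, partialD i u p = 0 := by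
  have hpi : (0 : ℝ) ≤ 2 * π := by positivity
  have hc : Continuous (partialD i u) := (hu.partialD i).smooth.continuous
  have hd : Differentiable ℝ u := hu.smooth.differentiable (by simp)
  rw [square, Measure.volume_eq_prod]
  -- Fubini with the variable of differentiation innermost, which needs a swap for `γ`; the inner
  -- integral vanishes by periodicity.
  fin_cases i
  · rw [← setIntegral_prod_swap, setIntegral_prod]
    · refine integral_eq_zero_of_ae (Filter.Eventually.of_forall fun y => ?_)
      simp only [Prod.swap_prod_mk]
      have hx : ∀ x, HasDerivAt (fun t => u (t, y)) (partialD 0 u (x, y)) x := fun x =>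
        (hd (x, y)).hasFDerivAt.comp_hasDerivAt x
          ((hasDerivAt_id x).prodMk (hasDerivAt_const x y))
      refine (setIntegral_Icc_deriv hpi hx (hc.comp (by fun_prop))).trans ?_
      have := hu.periodic_fst 0 y
      rw [zero_add] at this
      simp [this]
    · exact (hc.comp continuous_swap).continuousOn.integrableOn_compact isCompact_square
  · rw [setIntegral_prod]
    · refine integral_eq_zero_of_ae (Filter.Eventually.of_forall fun x => ?_)
      have hy : ∀ y, HasDerivAt (fun t => u (x, t)) (partialD 1 u (x, y)) y := fun y =>
        (hd (x, y)).hasFDerivAt.comp_hasDerivAt y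
          ((hasDerivAt_const y x).prodMk (hasDerivAt_id y))
      refine (setIntegral_Icc_deriv hpi hy (hc.comp (by fun_prop))).trans ?_
      have := hu.periodic_snd x 0
      rw [zero_add] at this
      simp [this]
    · exact hc.continuousOn.integrableOn_compact isCompact_square

end Integrals

/-! ### Symmetry of the second variation -/

/-- The `L²` pairing of vector fields along a map. -/
def pairL2 (V W : ℝ × ℝ → E3) : ℝ := ∫ p in square, inner ℝ (V p) (W p)

section Symmetry

variable {φ : SphereMap} {V V' W W' : ℝ × ℝ → E3}

theorem pairL2_comm (V W : ℝ × ℝ → E3) : pairL2 V W = pairL2 W V := by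
  simp only [pairL2, real_inner_comm]

theorem pairL2_add_left (hV : SmoothOnTorus V) (hV' : SmoothOnTorus V') (hW : SmoothOnTorus W) :
    pairL2 (fun p => V p + V' p) W = pairL2 V W + pairL2 V' W := by
  simp only [pairL2, inner_add_left]
  exact integral_add (hV.inner hW).integrableOn (hV'.inner hW).integrableOn

theorem pairL2_smul_left (c : ℝ) (V W : ℝ × ℝ → E3) :
    pairL2 (fun p => c • V p) W = c * pairL2 V W := by
  simp only [pairL2, real_inner_smul_left]
  exact integral_const_mul _ _

theorem pairL2_add_right (hV : SmoothOnTorus V) (hV' : SmoothOnTorus V') (hW : SmoothOnTorus W) :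
    pairL2 W (fun p => V p + V' p) = pairL2 W V + pairL2 W V' := by
  rw [pairL2_comm, pairL2_add_left hV hV' hW, pairL2_comm V, pairL2_comm V']

/-- The pull-back connection is compatible with the metric. -/
theorem partialD_inner_eq_nabla (hV : IsSection φ V) (hW : IsSection φ W) (i : Fin 2)
    (p : ℝ × ℝ) : partialD i (fun q => inner ℝ (V q) (W q)) p
      = inner ℝ (nabla φ i V p) (W p) + inner ℝ (V p) (nabla φ i W p) := by
  have h2 : inner ℝ (V p) (φ.toFun p) = (0 : ℝ) := by rw [real_inner_comm]; exact hV.2 p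
  rw [partialD_inner hV.1 hW.1]
  simp only [nabla, inner_sub_left, inner_sub_right, real_inner_smul_left, real_inner_smul_right,
    hW.2 p, h2]
  ring

/-- Metric compatibility, integrated: the derivative of `⟨V, W⟩` has zero integral. -/
theorem pairL2_nabla (hV : IsSection φ V) (hW : IsSection φ W) (i : Fin 2) :
    pairL2 (nabla φ i V) W = -pairL2 V (nabla φ i W) := by
  have h := integral_partialD (hV.1.inner hW.1) i
  simp only [partialD_inner_eq_nabla hV hW] at h
  rw [integral_add ((isSection_nabla hV.1 i).1.inner hW.1).integrableOn
    (hV.1.inner (isSection_nabla hW.1 i).1).integrableOn] at h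
  simp only [pairL2]
  linarith

theorem roughLaplacian_eq (V : ℝ × ℝ → E3) : roughLaplacian φ V = fun p =>
    (-1 : ℝ) • (nabla φ 0 (nabla φ 0 V) p + nabla φ 1 (nabla φ 1 V) p) := by
  funext p
  simp only [roughLaplacian, Fin.sum_univ_two]
  module

theorem pairL2_roughLaplacian_eq (hV : IsSection φ V) (hW : IsSection φ W) :
    pairL2 (roughLaplacian φ V) W
      = pairL2 (nabla φ 0 V) (nabla φ 0 W) + pairL2 (nabla φ 1 V) (nabla φ 1 W) := by
  have n1 := fun i => isSection_nabla (φ := φ) hV.1 i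
  have n2 := fun i => isSection_nabla (φ := φ) (n1 i).1 i
  rw [roughLaplacian_eq, pairL2_smul_left, pairL2_add_left (n2 0).1 (n2 1).1 hW.1,
    pairL2_nabla (n1 0) hW, pairL2_nabla (n1 1) hW]
  ring

theorem pairL2_roughLaplacian (hV : IsSection φ V) (hW : IsSection φ W) :
    pairL2 (roughLaplacian φ V) W = pairL2 V (roughLaplacian φ W) := by
  rw [pairL2_roughLaplacian_eq hV hW, pairL2_comm V, pairL2_roughLaplacian_eq hW hV,
    pairL2_comm (nabla φ 0 V), pairL2_comm (nabla φ 1 V)]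

/-- The zeroth order part `T(V) - |dφ|² V` of the Jacobi operator. -/
def curvaturePart (φ : SphereMap) (V : ℝ × ℝ → E3) : ℝ × ℝ → E3 :=
  fun q => traceD φ V q - normSqD φ q • V q

theorem isSection_curvaturePart (hV : IsSection φ V) : IsSection φ (curvaturePart φ V) :=
  (isSection_traceD hV).sub (IsSection.smul smoothOnTorus_normSqD hV)

theorem inner_curvaturePart (V W : ℝ × ℝ → E3) (p : ℝ × ℝ) :
    inner ℝ (curvaturePart φ V p) (W p) = inner ℝ (V p) (curvaturePart φ W p) := by
  simp only [curvaturePart, traceD, Fin.sum_univ_two, inner_sub_right, inner_add_right,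
    real_inner_smul_right, real_inner_comm (W p)]
  ring

/-- The first order part of the second variation. -/
def firstOrderPart (φ : SphereMap) (V : ℝ × ℝ → E3) : ℝ × ℝ → E3 := fun p =>
  secondVariation φ V p - roughLaplacian φ (roughLaplacian φ V) p
    - roughLaplacian φ (curvaturePart φ V) p - curvaturePart φ (roughLaplacian φ V) p

theorem isSection_firstOrderPart (hV : IsSection φ V) : IsSection φ (firstOrderPart φ V) :=
  (((isSection_secondVariation hV).sub (isSection_roughLaplacian (isSection_roughLaplacian hV))).sub
    (isSection_roughLaplacian (isSection_curvaturePart hV))).sub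
    (isSection_curvaturePart (isSection_roughLaplacian hV))

/-- The flux whose divergence is the defect of symmetry of the first order part. -/
def flux (φ : SphereMap) (V W : ℝ × ℝ → E3) (i : Fin 2) (p : ℝ × ℝ) : ℝ :=
  inner ℝ (tension φ p) (W p) * inner ℝ (dmap φ i p) (V p)
    - inner ℝ (tension φ p) (V p) * inner ℝ (dmap φ i p) (W p)

theorem smoothOnTorus_flux (hV : IsSection φ V) (hW : IsSection φ W) (i : Fin 2) :
    SmoothOnTorus (flux φ V W i) := by
  have ht := (isSection_tension (φ := φ)).1
  have hd := (isSection_dmap (φ := φ) i).1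
  have h := ((ht.inner hW.1).smul (hd.inner hV.1)).add
    ((SmoothOnTorus.const (-1 : ℝ)).smul ((ht.inner hV.1).smul (hd.inner hW.1)))
  have e : flux φ V W i = fun p => inner ℝ (tension φ p) (W p) • inner ℝ (dmap φ i p) (V p)
    + (-1 : ℝ) • (inner ℝ (tension φ p) (V p) • inner ℝ (dmap φ i p) (W p)) := by
    funext p; simp [flux]; ring
  rw [e]; exact h

theorem partialD_flux (hV : IsSection φ V) (hW : IsSection φ W) (i : Fin 2) (p : ℝ × ℝ) :
    partialD i (flux φ V W i) p =
      (inner ℝ (nabla φ i (tension φ) p) (W p) + inner ℝ (tension φ p) (nabla φ i W p))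
          * inner ℝ (dmap φ i p) (V p)
        + inner ℝ (tension φ p) (W p)
          * (inner ℝ (nabla φ i (dmap φ i) p) (V p) + inner ℝ (dmap φ i p) (nabla φ i V p))
        - ((inner ℝ (nabla φ i (tension φ) p) (V p) + inner ℝ (tension φ p) (nabla φ i V p))
          * inner ℝ (dmap φ i p) (W p)
        + inner ℝ (tension φ p) (V p)
          * (inner ℝ (nabla φ i (dmap φ i) p) (W p) + inner ℝ (dmap φ i p) (nabla φ i W p))) := by
  have ht := isSection_tension (φ := φ)
  have hd := isSection_dmap (φ := φ) i
  have e : flux φ V W i = fun p => inner ℝ (tension φ p) (W p) • inner ℝ (dmap φ i p) (V p)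
    + (-1 : ℝ) • (inner ℝ (tension φ p) (V p) • inner ℝ (dmap φ i p) (W p)) := by
    funext p; simp [flux]; ring
  rw [e, partialD_add ((ht.1.inner hW.1).smul (hd.1.inner hV.1))
    ((SmoothOnTorus.const (-1 : ℝ)).smul ((ht.1.inner hV.1).smul (hd.1.inner hW.1))),
    partialD_const_smul ((ht.1.inner hV.1).smul (hd.1.inner hW.1)),
    partialD_smul (ht.1.inner hW.1) (hd.1.inner hV.1),
    partialD_smul (ht.1.inner hV.1) (hd.1.inner hW.1),
    partialD_inner_eq_nabla ht hW, partialD_inner_eq_nabla hd hV,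
    partialD_inner_eq_nabla ht hV, partialD_inner_eq_nabla hd hW]
  simp only [smul_eq_mul]
  ring

/-- The pointwise symmetric terms drop out. The rest are the terms of the divergence of the flux
that differentiate `τ`, `V` or `W`; those that differentiate `dφ` sum to `⟨τ, W⟩⟨τ, V⟩ - ⟨τ, V⟩⟨τ,
W⟩ = 0`, because `∑ ∇ᵢ dφ(eᵢ) = τ`. -/
theorem inner_firstOrderPart_sub (hV : IsSection φ V) (hW : IsSection φ W) (p : ℝ × ℝ) :
    inner ℝ (firstOrderPart φ V p) (W p) - inner ℝ (V p) (firstOrderPart φ W p)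
      = 2 * (partialD 0 (flux φ V W 0) p + partialD 1 (flux φ V W 1) p) := by
  have ht : tension φ p = nabla φ 0 (dmap φ 0) p + nabla φ 1 (dmap φ 1) p := by
    simp [tension, Fin.sum_univ_two]
  rw [partialD_flux hV hW, partialD_flux hV hW]
  have e (V : ℝ × ℝ → E3) : firstOrderPart φ V p =
      (2 * pairingD φ (tension φ) p) • V p
    + (‖tension φ p‖ ^ 2) • V p
    - (2 : ℝ) • ∑ i, (inner ℝ (V p) (nabla φ i (tension φ) p)) • dmap φ i p
    - (2 : ℝ) • ∑ i, (inner ℝ (tension φ p) (nabla φ i V p)) • dmap φ i p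
    - (inner ℝ (tension φ p) (V p)) • tension φ p
    + traceD φ (traceD φ V) p
    - (2 * normSqD φ p) • traceD φ V p
    + (2 * pairingD φ V p) • tension φ p
    + (normSqD φ p ^ 2) • V p := by
    simp only [firstOrderPart, secondVariation]
    unfold curvaturePart
    module
  have hT (V W : ℝ × ℝ → E3) : inner ℝ (traceD φ V p) (W p) = inner ℝ (V p) (traceD φ W p) := by
    simp only [traceD, Fin.sum_univ_two, inner_add_right, real_inner_smul_right,
      real_inner_comm (W p)]
    ring
  rw [e, e]
  simp only [inner_sub_left, inner_sub_right, inner_add_left, inner_add_right,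
    real_inner_smul_left, real_inner_smul_right, Fin.sum_univ_two, hT, pairingD]
  have c0 : inner ℝ (nabla φ 0 (dmap φ 0) p) (V p) + inner ℝ (nabla φ 1 (dmap φ 1) p) (V p)
      = inner ℝ (tension φ p) (V p) := by rw [ht, inner_add_left]
  have c1 : inner ℝ (nabla φ 0 (dmap φ 0) p) (W p) + inner ℝ (nabla φ 1 (dmap φ 1) p) (W p)
      = inner ℝ (tension φ p) (W p) := by rw [ht, inner_add_left]
  simp only [real_inner_comm (tension φ p) (V p), real_inner_comm (dmap φ _ p) (V p),
    real_inner_comm (dmap φ _ p) (nabla φ _ V p), real_inner_comm (dmap φ _ p) (nabla φ _ W p),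
    real_inner_comm (nabla φ _ (tension φ) p) (V p),
    real_inner_comm (nabla φ _ (tension φ) p) (W p)]
  linear_combination (2 * inner ℝ (tension φ p) (V p)) * c1
    - (2 * inner ℝ (tension φ p) (W p)) * c0

theorem pairL2_firstOrderPart (hV : IsSection φ V) (hW : IsSection φ W) :
    pairL2 (firstOrderPart φ V) W = pairL2 V (firstOrderPart φ W) := by
  rw [← sub_eq_zero, pairL2, pairL2,
    ← integral_sub ((isSection_firstOrderPart hV).1.inner hW.1).integrableOn
      (hV.1.inner (isSection_firstOrderPart hW).1).integrableOn]
  simp only [inner_firstOrderPart_sub hV hW]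
  have h := fun i => smoothOnTorus_flux hV hW i
  rw [integral_const_mul, integral_add ((h 0).partialD 0).integrableOn
    ((h 1).partialD 1).integrableOn, integral_partialD (h 0), integral_partialD (h 1)]
  simp

/-- With `C` the curvature part and `F` the first order part, this reads `I₂ = Δ̄² + Δ̄C + CΔ̄ + F`.
As `Δ̄`, `C` and `F` are symmetric, the two middle terms are adjoint to each other. -/
theorem secondVariation_eq (V : ℝ × ℝ → E3) : secondVariation φ V = fun p =>
    roughLaplacian φ (roughLaplacian φ V) p + (roughLaplacian φ (curvaturePart φ V) p
      + (curvaturePart φ (roughLaplacian φ V) p + firstOrderPart φ V p)) := by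
  funext p
  simp only [firstOrderPart]
  abel

/-- The second variation operator is symmetric in `L²`. -/
theorem pairL2_secondVariation (hV : IsSection φ V) (hW : IsSection φ W) :
    pairL2 (secondVariation φ V) W = pairL2 V (secondVariation φ W) := by
  have hL {V} (hV : IsSection φ V) := isSection_roughLaplacian hV
  have hC {V} (hV : IsSection φ V) := isSection_curvaturePart hV
  have hF {V} (hV : IsSection φ V) := isSection_firstOrderPart hV
  have hCs {V W} (_ : IsSection φ V) (_ : IsSection φ W) :
      pairL2 (curvaturePart φ V) W = pairL2 V (curvaturePart φ W) := by
    simp only [pairL2, inner_curvaturePart]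
  rw [secondVariation_eq V, secondVariation_eq W,
    pairL2_add_left (hL (hL hV)).1 ((hL (hC hV)).add ((hC (hL hV)).add (hF hV))).1 hW.1,
    pairL2_add_left (hL (hC hV)).1 ((hC (hL hV)).add (hF hV)).1 hW.1,
    pairL2_add_left (hC (hL hV)).1 (hF hV).1 hW.1,
    pairL2_add_right (hL (hL hW)).1 ((hL (hC hW)).add ((hC (hL hW)).add (hF hW))).1 hV.1,
    pairL2_add_right (hL (hC hW)).1 ((hC (hL hW)).add (hF hW)).1 hV.1,
    pairL2_add_right (hC (hL hW)).1 (hF hW).1 hV.1,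
    pairL2_roughLaplacian (hL hV) hW, pairL2_roughLaplacian hV (hL hW),
    pairL2_roughLaplacian (hC hV) hW, hCs hV (hL hW), hCs (hL hV) hW,
    pairL2_roughLaplacian hV (hC hW), pairL2_firstOrderPart hV hW]
  ring

end Symmetry

/-! ### The `L²` inner product of modes -/

theorem continuous_trig (j : ℤ) : Continuous (trig j) := (contDiff_trig j).continuous

theorem trig_sq_add_trig_neg_sq {j : ℤ} (hj : j ≠ 0) (x : ℝ) :
    trig j x ^ 2 + trig (-j) x ^ 2 = π⁻¹ := by
  have h : ((√π)⁻¹) ^ 2 = π⁻¹ := by rw [inv_pow, Real.sq_sqrt pi_pos.le]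
  have hsc := sin_sq_add_cos_sq (j * x)
  rcases lt_or_gt_of_ne hj with hj | hj
  · simp [trig, hj.ne, hj.le, not_le.2 hj, mul_pow]
    linear_combination h + (√π)⁻¹ ^ 2 * hsc
  · simp [trig, hj.ne', hj.le, not_le.2 hj, mul_pow]
    linear_combination h + (√π)⁻¹ ^ 2 * hsc

/-- Integration by parts alone suffices: it relates the integrals of `e_{-i} e_j` and `e_i e_{-j}`,
and using it twice gives `(i² - j²) ∫ e_i e_j = 0`. The case `i = -j` needs one use only. For `i = j
≠ 0`, `e_i²` and `e_{-i}²` have equal integrals with sum `2`. -/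
theorem integral_trig_mul_trig (i j : ℤ) :
    ∫ x in Set.Icc 0 (2 * π), trig i x * trig j x = if i = j then 1 else 0 := by
  have hpi : (0 : ℝ) ≤ 2 * π := by positivity
  have hper (j : ℤ) : trig j (2 * π) = trig j 0 := by simpa using trig_add_two_pi j 0
  have hint (i j : ℤ) : IntegrableOn (fun x => trig i x * trig j x) (Set.Icc 0 (2 * π)) :=
    ((continuous_trig i).mul (continuous_trig j)).continuousOn.integrableOn_compact isCompact_Icc
  have key (i j : ℤ) : i * ∫ x in Set.Icc 0 (2 * π), trig (-i) x * trig j x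
      = -(j * ∫ x in Set.Icc 0 (2 * π), trig i x * trig (-j) x) := by
    have h := setIntegral_Icc_deriv hpi
      (fun x => (hasDerivAt_trig i x).mul (hasDerivAt_trig j x))
      (((continuous_const.mul (continuous_trig (-i))).mul (continuous_trig j)).add
        ((continuous_trig i).mul (continuous_const.mul (continuous_trig (-j)))))
    simp only [Pi.mul_apply, hper, sub_self] at h
    have e : (fun x => -(i : ℝ) * trig (-i) x * trig j x + trig i x * (-(j : ℝ) * trig (-j) x))
        = fun x => -(i : ℝ) * (trig (-i) x * trig j x) + -(j : ℝ) * (trig i x * trig (-j) x) := by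
      funext x; ring
    rw [e, integral_add ((hint _ _).const_mul _) ((hint _ _).const_mul _), integral_const_mul,
      integral_const_mul] at h
    linarith
  by_cases h0 : i = j
  · subst h0
    rw [if_pos rfl]
    by_cases hi : i = 0
    · subst hi
      have : ((√(2 * π))⁻¹) ^ 2 = (2 * π)⁻¹ := by rw [inv_pow, Real.sq_sqrt hpi]
      have e (x : ℝ) : trig 0 x * trig 0 x = (2 * π)⁻¹ := by
        rw [← this]; simp [trig]; ring
      simp only [e]
      rw [setIntegral_const, measureReal_def, Real.volume_Icc, sub_zero, ENNReal.toReal_ofReal hpi,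
        smul_eq_mul]
      field_simp
    · have h1 := key i (-i)
      rw [neg_neg] at h1
      push_cast at h1
      have hi' : (i : ℝ) ≠ 0 := by exact_mod_cast hi
      have h2 : ∫ x in Set.Icc 0 (2 * π), trig (-i) x * trig (-i) x
          = ∫ x in Set.Icc 0 (2 * π), trig i x * trig i x := by
        apply mul_left_cancel₀ hi'
        linarith
      have h3 : ∫ x in Set.Icc 0 (2 * π), (trig i x * trig i x + trig (-i) x * trig (-i) x) = 2 := by
        have e (x : ℝ) : trig i x * trig i x + trig (-i) x * trig (-i) x = π⁻¹ := by
          rw [← trig_sq_add_trig_neg_sq hi x]; ring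
        simp only [e]
        rw [setIntegral_const, measureReal_def, Real.volume_Icc, sub_zero,
          ENNReal.toReal_ofReal hpi, smul_eq_mul]
        field_simp
      rw [integral_add (hint _ _) (hint _ _), h2] at h3
      linarith
  · rw [if_neg h0]
    have h1 := key i (-j)
    have h2 := key (-i) j
    rw [neg_neg] at h1 h2
    push_cast at h1 h2
    by_cases hij : i = -j
    · subst hij
      have hj : (j : ℝ) ≠ 0 := by
        intro h
        have : j = 0 := by exact_mod_cast h
        subst this
        simp at h0
      simp only [neg_neg, Int.cast_neg] at h2
      have e : ∫ x in Set.Icc 0 (2 * π), trig j x * trig (-j) x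
        = ∫ x in Set.Icc 0 (2 * π), trig (-j) x * trig j x := by simp only [mul_comm]
      rw [e] at h2
      have h3 : (j : ℝ) * ∫ x in Set.Icc 0 (2 * π), trig (-j) x * trig j x = 0 := by linarith
      exact (mul_eq_zero.1 h3).resolve_left hj
    · have h3 : ((i : ℝ) ^ 2 - j ^ 2) * ∫ x in Set.Icc 0 (2 * π), trig i x * trig j x = 0 := by
        linear_combination (-i : ℝ) * h2 + j * h1
      refine (mul_eq_zero.1 h3).resolve_left ?_
      have ha : (i : ℝ) - j ≠ 0 := by
        rw [sub_ne_zero]; exact_mod_cast h0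
      have hb : (i : ℝ) + j ≠ 0 := by
        intro h
        apply hij
        have : i + j = 0 := by exact_mod_cast h
        omega
      have := mul_ne_zero ha hb
      intro h
      apply this
      linear_combination h

theorem integral_trig₂_mul_trig₂ (i j i' j' : ℤ) :
    ∫ p in square, trig₂ i j p * trig₂ i' j' p = if i = i' ∧ j = j' then 1 else 0 := by
  have e : (fun p : ℝ × ℝ => trig₂ i j p * trig₂ i' j' p)
      = fun p => (trig i p.1 * trig i' p.1) * (trig j p.2 * trig j' p.2) := by
    funext p; simp only [trig₂]; ring
  rw [e, square, Measure.volume_eq_prod]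
  rw [setIntegral_prod_mul (fun x => trig i x * trig i' x) (fun x => trig j x * trig j' x),
    integral_trig_mul_trig, integral_trig_mul_trig]
  by_cases h : i = i' <;> by_cases h' : j = j' <;> simp [h, h']

theorem pairL2_mode (k : ℕ) (i j i' j' : ℤ) (A B A' B' : ℝ) :
    pairL2 (mode k i j A B) (mode k i' j' A' B')
      = if i = i' ∧ j = j' then A * A' + B * B' else 0 := by
  have h (i j i' j' : ℤ) : IntegrableOn (fun p => trig₂ i j p * trig₂ i' j' p) square :=
    ((smoothOnTorus_trig₂ i j).smul (smoothOnTorus_trig₂ i' j')).integrableOn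
  have e (p : ℝ × ℝ) : inner ℝ (mode k i j A B p) (mode k i' j' A' B' p)
      = (A * A') * (trig₂ i j p * trig₂ i' j' p)
        + (B * B') * (trig₂ (-i) j p * trig₂ (-i') j' p) := by
    rw [mode, mode, inner_frameField]; ring
  simp only [pairL2, e]
  rw [integral_add ((h _ _ _ _).const_mul _) ((h _ _ _ _).const_mul _), integral_const_mul,
    integral_const_mul, integral_trig₂_mul_trig₂, integral_trig₂_mul_trig₂]
  by_cases h : i = i' <;> by_cases h' : j = j' <;> simp [h, h']

/-! ### Uniform approximation by trigonometric polynomials -/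

/-- Real trigonometric polynomials on the torus. -/
def trigPoly : Submodule ℝ (ℝ × ℝ → ℝ) := Submodule.span ℝ (Set.range fun ij : ℤ × ℤ =>
  trig₂ ij.1 ij.2)

theorem trig₂_mem_trigPoly (i j : ℤ) : trig₂ i j ∈ trigPoly := Submodule.subset_span ⟨(i, j), rfl⟩

theorem exists_cos_eq_trig (n : ℤ) : ∃ (c : ℝ) (j : ℤ), ∀ x : ℝ, cos (n * x) = c * trig j x := by
  by_cases h : n = 0
  · refine ⟨√(2 * π), 0, fun x => ?_⟩
    have : √(2 * π) ≠ 0 := by positivity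
    rw [trig, if_pos rfl, if_pos le_rfl, mul_inv_cancel_left₀ this, h]
  · refine ⟨√π, |n|, fun x => ?_⟩
    have : √π ≠ 0 := by positivity
    have e : cos (((|n| : ℤ) : ℝ) * x) = cos (n * x) := by
      rcases abs_choice n with h | h <;> simp [h]
    rw [trig, if_neg (by simpa using h), if_pos (abs_nonneg n), e, mul_inv_cancel_left₀ this]

theorem exists_sin_eq_trig (n : ℤ) : ∃ (c : ℝ) (j : ℤ), ∀ x : ℝ, sin (n * x) = c * trig j x := by
  rcases lt_trichotomy n 0 with h | h | h
  · refine ⟨-√π, n, fun x => ?_⟩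
    have : √π ≠ 0 := by positivity
    rw [trig, if_neg h.ne, if_neg (not_le.2 h), neg_mul, mul_inv_cancel_left₀ this, sin_neg,
      neg_neg]
  · exact ⟨0, 0, fun x => by simp [h]⟩
  · refine ⟨√π, -n, fun x => ?_⟩
    have : √π ≠ 0 := by positivity
    rw [trig, if_neg (by omega), if_neg (by omega), mul_inv_cancel_left₀ this]
    simp

theorem mul_mem_trigPoly {u v : ℝ → ℝ} (hu : ∃ (c : ℝ) (j : ℤ), ∀ x : ℝ, u x = c * trig j x)
    (hv : ∃ (c : ℝ) (j : ℤ), ∀ x : ℝ, v x = c * trig j x) :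
    (fun p : ℝ × ℝ => u p.1 * v p.2) ∈ trigPoly := by
  obtain ⟨c, i, hc⟩ := hu
  obtain ⟨d, j, hd⟩ := hv
  have e : (fun p : ℝ × ℝ => u p.1 * v p.2) = (c * d) • trig₂ i j := by
    funext p
    simp only [hc, hd, trig₂, Pi.smul_apply, smul_eq_mul]
    ring
  rw [e]
  exact trigPoly.smul_mem _ (trig₂_mem_trigPoly i j)

/-- The covering of the unit torus by the plane, in coordinates of period `2π`. -/
def toUnitTorus (p : ℝ × ℝ) : UnitAddTorus (Fin 2) :=
  ![((p.1 / (2 * π) : ℝ) : UnitAddCircle), ((p.2 / (2 * π) : ℝ) : UnitAddCircle)]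

theorem fourier_div_two_pi (n : ℤ) (x : ℝ) :
    fourier n ((x / (2 * π) : ℝ) : UnitAddCircle)
      = (cos (n * x) : ℂ) + (sin (n * x) : ℂ) * Complex.I := by
  have hpi : (π : ℂ) ≠ 0 := by exact_mod_cast pi_ne_zero
  rw [fourier_coe_apply, Complex.ofReal_cos, Complex.ofReal_sin, ← Complex.exp_mul_I]
  congr 1
  push_cast
  field_simp

theorem re_im_mFourier_mem (n : Fin 2 → ℤ) :
    (fun p => (UnitAddTorus.mFourier n (toUnitTorus p)).re) ∈ trigPoly ∧
      (fun p => (UnitAddTorus.mFourier n (toUnitTorus p)).im) ∈ trigPoly := by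
  have e (p : ℝ × ℝ) : UnitAddTorus.mFourier n (toUnitTorus p)
      = ((cos (n 0 * p.1) : ℂ) + (sin (n 0 * p.1) : ℂ) * Complex.I)
        * ((cos (n 1 * p.2) : ℂ) + (sin (n 1 * p.2) : ℂ) * Complex.I) := by
    rw [← fourier_div_two_pi, ← fourier_div_two_pi]
    simp [UnitAddTorus.mFourier, Fin.prod_univ_two, toUnitTorus]
  have c0 := exists_cos_eq_trig (n 0)
  have c1 := exists_cos_eq_trig (n 1)
  have s0 := exists_sin_eq_trig (n 0)
  have s1 := exists_sin_eq_trig (n 1)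
  constructor
  · convert trigPoly.sub_mem (mul_mem_trigPoly c0 c1) (mul_mem_trigPoly s0 s1) using 1
    funext p
    rw [e]
    simp [-Complex.ofReal_cos, -Complex.ofReal_sin]
  · convert trigPoly.add_mem (mul_mem_trigPoly c0 s1) (mul_mem_trigPoly s0 c1) using 1
    funext p
    rw [e]
    simp [-Complex.ofReal_cos, -Complex.ofReal_sin]

/-- Complex scalars mix real and imaginary parts, so the induction must carry both. -/
theorem re_im_mem_of_mem_span {G : C(UnitAddTorus (Fin 2), ℂ)}
    (hG : G ∈ Submodule.span ℂ (Set.range (UnitAddTorus.mFourier (d := Fin 2)))) :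
    (fun p => (G (toUnitTorus p)).re) ∈ trigPoly ∧ (fun p => (G (toUnitTorus p)).im) ∈ trigPoly := by
  induction hG using Submodule.span_induction with
  | mem x hx =>
    obtain ⟨n, rfl⟩ := hx
    exact re_im_mFourier_mem n
  | zero => exact ⟨trigPoly.zero_mem, trigPoly.zero_mem⟩
  | add x y _ _ hx hy => exact ⟨trigPoly.add_mem hx.1 hy.1, trigPoly.add_mem hx.2 hy.2⟩
  | smul c x _ hx =>
    constructor
    · convert trigPoly.sub_mem (trigPoly.smul_mem c.re hx.1) (trigPoly.smul_mem c.im hx.2) using 1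
      funext p
      simp
    · convert trigPoly.add_mem (trigPoly.smul_mem c.re hx.2) (trigPoly.smul_mem c.im hx.1) using 1
      funext p
      simp

theorem SmoothOnTorus.eq_of_toUnitTorus_eq {F : Type*} [NormedAddCommGroup F] [NormedSpace ℝ F]
    {f : ℝ × ℝ → F} (hf : SmoothOnTorus f) {p q : ℝ × ℝ} (h : toUnitTorus p = toUnitTorus q) :
    f p = f q := by
  have key {x y : ℝ} (h : ((x / (2 * π) : ℝ) : UnitAddCircle) = ((y / (2 * π) : ℝ) : UnitAddCircle)) :
      ∃ n : ℤ, y = x + n * (2 * π) := by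
    rw [eq_comm, ← sub_eq_zero, ← AddCircle.coe_sub, AddCircle.coe_eq_zero_iff] at h
    obtain ⟨n, hn⟩ := h
    refine ⟨n, ?_⟩
    have hpi : π ≠ 0 := pi_ne_zero
    rw [zsmul_eq_mul, mul_one] at hn
    rw [hn]
    field_simp
    ring
  obtain ⟨m, hm⟩ := key (congrFun h 0)
  obtain ⟨n, hn⟩ := key (congrFun h 1)
  have h1 : Function.Periodic (fun t => f (t, p.2)) (2 * π) := fun t => hf.periodic_fst t p.2
  have h2 : Function.Periodic (fun t => f (q.1, t)) (2 * π) := fun t => hf.periodic_snd q.1 t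
  have e1 := h1.int_mul m p.1
  have e2 := h2.int_mul n p.2
  simp only [← hm, ← hn] at e1 e2
  rw [show p = (p.1, p.2) from rfl, ← e1, ← e2]

/-- Needed for a doubly periodic continuous function to descend to a continuous function on the
torus. -/
theorem isOpenQuotientMap_toUnitTorus : IsOpenQuotientMap toUnitTorus := by
  have h1 : IsOpenQuotientMap (Pi.map fun (_ : Fin 2) (x : ℝ) => (x : UnitAddCircle)) :=
    IsOpenQuotientMap.piMap fun _ => QuotientAddGroup.isOpenQuotientMap_mk
  have hpi : (2 * π)⁻¹ ≠ 0 := by positivity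
  have h2 := (((Homeomorph.mulRight₀ _ hpi).prodCongr (Homeomorph.mulRight₀ _ hpi)).trans
    (UniformEquiv.finTwoArrow ℝ).symm.toHomeomorph).isOpenQuotientMap
  convert h1.comp h2 using 1
  funext p i
  fin_cases i <;> rfl

/-- Descend `f` to the unit torus, approximate it by characters in the uniform norm, and take real
parts. -/
theorem SmoothOnTorus.exists_trigPoly {f : ℝ × ℝ → ℝ} (hf : SmoothOnTorus f) {ε : ℝ} (hε : 0 < ε) :
    ∃ g ∈ trigPoly, ∀ p, |f p - g p| < ε := by
  have hq := isOpenQuotientMap_toUnitTorus.isQuotientMap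
  let f' : C(ℝ × ℝ, ℂ) := ⟨fun p => (f p : ℂ),
    Complex.continuous_ofReal.comp hf.smooth.continuous⟩
  let π' : C(ℝ × ℝ, UnitAddTorus (Fin 2)) := ⟨toUnitTorus, hq.continuous⟩
  have hq' : Topology.IsQuotientMap π' := hq
  have hfac : Function.FactorsThrough f' π' := fun p q h => by
    simp [f', hf.eq_of_toUnitTorus_eq h]
  have hF : ∀ p, hq'.lift f' hfac (toUnitTorus p) = f p := fun p =>
    congrArg (fun u : C(ℝ × ℝ, ℂ) => u p) (hq'.lift_comp f' hfac)
  have hmem : hq'.lift f' hfac ∈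
      (Submodule.span ℂ (Set.range (UnitAddTorus.mFourier (d := Fin 2)))).topologicalClosure := by
    rw [UnitAddTorus.span_mFourier_closure_eq_top]
    trivial
  obtain ⟨G, hG, hd⟩ := Metric.mem_closure_iff.1 hmem ε hε
  refine ⟨_, (re_im_mem_of_mem_span hG).1, fun p => ?_⟩
  have h1 := (ContinuousMap.dist_apply_le_dist (f := hq'.lift f' hfac) (g := G)
    (toUnitTorus p)).trans_lt hd
  rw [hF, dist_eq_norm] at h1
  refine lt_of_le_of_lt ?_ h1
  simpa using Complex.abs_re_le_norm ((f p : ℂ) - G (toUnitTorus p))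

/-! ### Density of modes -/

/-- `mode` as an element of the space of sections. -/
def modeSection (k : ℕ) (i j : ℤ) (A B : ℝ) : sections (phi k) :=
  ⟨mode k i j A B, isSection_mode k i j A B⟩

/-- The span of all modes. -/
def modeSpan (k : ℕ) : Submodule ℝ (sections (phi k)) :=
  Submodule.span ℝ (Set.range fun x : (ℤ × ℤ) × ℝ × ℝ => modeSection k x.1.1 x.1.2 x.2.1 x.2.2)

theorem modeSection_mem_modeSpan (k : ℕ) (i j : ℤ) (A B : ℝ) :
    modeSection k i j A B ∈ modeSpan k := Submodule.subset_span ⟨((i, j), A, B), rfl⟩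

theorem exists_mem_modeSpan_tangent (k : ℕ) {f : ℝ × ℝ → ℝ} (hf : f ∈ trigPoly) :
    ∃ W ∈ modeSpan k, W.1 = frameField k f 0 := by
  induction hf using Submodule.span_induction with
  | mem x hx =>
    obtain ⟨ij, rfl⟩ := hx
    refine ⟨_, modeSection_mem_modeSpan k ij.1 ij.2 1 0, ?_⟩
    funext p
    simp [modeSection, mode_apply, frameField]
  | zero => exact ⟨0, Submodule.zero_mem _, by funext p; simp [frameField]⟩
  | add x y _ _ hx hy =>
    obtain ⟨W, hW, e⟩ := hx
    obtain ⟨W', hW', e'⟩ := hy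
    refine ⟨W + W', Submodule.add_mem _ hW hW', ?_⟩
    funext p
    simp [e, e', frameField, add_smul]
  | smul c x _ hx =>
    obtain ⟨W, hW, e⟩ := hx
    refine ⟨c • W, Submodule.smul_mem _ c hW, ?_⟩
    funext p
    simp [e, frameField, mul_smul]

theorem exists_mem_modeSpan_normal (k : ℕ) {g : ℝ × ℝ → ℝ} (hg : g ∈ trigPoly) :
    ∃ W ∈ modeSpan k, W.1 = frameField k 0 g := by
  induction hg using Submodule.span_induction with
  | mem x hx =>
    obtain ⟨ij, rfl⟩ := hx
    -- The sign compensates for the `-i` in the normal component of a mode.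
    refine ⟨_, modeSection_mem_modeSpan k (-ij.1) ij.2 0 1, ?_⟩
    funext p
    simp [modeSection, mode_apply, frameField]
  | zero => exact ⟨0, Submodule.zero_mem _, by funext p; simp [frameField]⟩
  | add x y _ _ hx hy =>
    obtain ⟨W, hW, e⟩ := hx
    obtain ⟨W', hW', e'⟩ := hy
    refine ⟨W + W', Submodule.add_mem _ hW hW', ?_⟩
    funext p
    simp [e, e', frameField, add_smul]
  | smul c x _ hx =>
    obtain ⟨W, hW, e⟩ := hx
    refine ⟨c • W, Submodule.smul_mem _ c hW, ?_⟩
    funext p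
    simp [e, frameField, mul_smul]

theorem exists_mem_modeSpan_pairL2_lt (k : ℕ) (V : sections (phi k)) {ε : ℝ} (hε : 0 < ε) :
    ∃ W ∈ modeSpan k, innerL2 (V - W) (V - W) < ε := by
  set M : ℝ := volume.real square with hM
  have hM0 : 0 ≤ M := measureReal_nonneg
  -- Each component contributes at most `η²`, so the integral is at most `2Mη² = εM/(M + 1) < ε`.
  set η : ℝ := √(ε / (2 * (M + 1))) with hη
  have hη0 : 0 < η := by positivity
  have hη2 : η ^ 2 = ε / (2 * (M + 1)) := Real.sq_sqrt (by positivity)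
  have hX : SmoothOnTorus fun p => inner ℝ (tangentField k p) (V.1 p) :=
    (smoothOnTorus_tangentField k).inner V.2.1
  have hN : SmoothOnTorus fun p => inner ℝ (normalField k p) (V.1 p) :=
    (smoothOnTorus_normalField k).inner V.2.1
  obtain ⟨f, hf, hf'⟩ := hX.exists_trigPoly hη0
  obtain ⟨g, hg, hg'⟩ := hN.exists_trigPoly hη0
  obtain ⟨W₁, hW₁, e₁⟩ := exists_mem_modeSpan_tangent k hf
  obtain ⟨W₂, hW₂, e₂⟩ := exists_mem_modeSpan_normal k hg
  refine ⟨W₁ + W₂, Submodule.add_mem _ hW₁ hW₂, ?_⟩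
  have hb (p : ℝ × ℝ) : inner ℝ ((V - (W₁ + W₂)).1 p) ((V - (W₁ + W₂)).1 p) ≤ 2 * η ^ 2 := by
    have e : (V - (W₁ + W₂)).1 = frameField k
        (fun p => inner ℝ (tangentField k p) (V.1 p) - f p)
        (fun p => inner ℝ (normalField k p) (V.1 p) - g p) := by
      funext p
      have := congrFun (frameField_inner V.2) p
      simp only [Submodule.coe_sub, Submodule.coe_add, Pi.sub_apply, Pi.add_apply, e₁, e₂]
      nth_rewrite 1 [← this]
      simp only [frameField, Pi.zero_apply]
      module
    rw [e, inner_frameField]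
    have h1 := sq_le_sq' (abs_lt.1 (hf' p)).1.le (abs_lt.1 (hf' p)).2.le
    have h2 := sq_le_sq' (abs_lt.1 (hg' p)).1.le (abs_lt.1 (hg' p)).2.le
    nlinarith
  have hint : IntegrableOn
      (fun p => inner ℝ ((V - (W₁ + W₂)).1 p) ((V - (W₁ + W₂)).1 p)) square :=
    ((V - (W₁ + W₂)).2.1.inner (V - (W₁ + W₂)).2.1).integrableOn
  calc innerL2 (V - (W₁ + W₂)) (V - (W₁ + W₂)) ≤ ∫ _ in square, 2 * η ^ 2 :=
        integral_mono hint (integrableOn_square continuous_const) hb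
    _ = M * (2 * η ^ 2) := by rw [setIntegral_const, smul_eq_mul]
    _ < ε := by
        rw [hη2]
        field_simp
        nlinarith

/-! ### Definiteness of the `L²` inner product -/

theorem innerL2_self_nonneg {φ : SphereMap} (V : sections φ) : 0 ≤ innerL2 V V :=
  integral_nonneg fun _ => real_inner_self_nonneg

theorem eq_zero_of_innerL2_self {φ : SphereMap} (V : sections φ) (h : innerL2 V V = 0) : V = 0 := by
  have hpi : (0 : ℝ) < 2 * π := by positivity
  have hs := V.2.1.inner V.2.1
  have hae := (setIntegral_eq_zero_iff_of_nonneg_ae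
    (Filter.Eventually.of_forall fun p => real_inner_self_nonneg) hs.integrableOn).1 h
  -- This upgrades almost everywhere vanishing of a continuous function to vanishing on the whole
  -- square; periodicity then reaches the plane.
  have hsub : square ⊆ closure (interior square) := by
    rw [square, interior_prod_eq, closure_prod_eq, interior_Icc, closure_Ioo hpi.ne]
  have hon := Measure.eqOn_of_ae_eq hae hs.smooth.continuous.continuousOn
    continuousOn_const hsub
  apply Subtype.ext
  funext p
  have h1 : Function.Periodic (fun t => V.1 (t, p.2)) (2 * π) := fun t => V.2.1.periodic_fst t p.2
  obtain ⟨x, hx, ex⟩ := h1.exists_mem_Ico₀ hpi p.1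
  have h2 : Function.Periodic (fun t => V.1 (x, t)) (2 * π) := fun t => V.2.1.periodic_snd x t
  obtain ⟨y, hy, ey⟩ := h2.exists_mem_Ico₀ hpi p.2
  have h0 := hon (Set.mk_mem_prod (Set.Ico_subset_Icc_self hx) (Set.Ico_subset_Icc_self hy))
  change V.1 (p.1, p.2) = 0
  rw [ex, ey]
  exact inner_self_eq_zero.1 h0

/-! ### Symmetric operators with an orthonormal basis of eigenvectors -/

section Abstract

variable {E ι : Type*} [AddCommGroup E] [Module ℝ E] {B : LinearMap.BilinForm ℝ E}
  {T : Module.End ℝ E} {b : ι → E} {lam : ι → ℝ}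

theorem bilin_sum_smul [DecidableEq ι] (h1 : ∀ i, B (b i) (b i) = 1)
    (h0 : ∀ i j, i ≠ j → B (b i) (b j) = 0) (s : Finset ι) (c : ι → ℝ) (j : ι) :
    B (∑ i ∈ s, c i • b i) (b j) = if j ∈ s then c j else 0 := by
  have h (i : ι) : B (b i) (b j) = if i = j then 1 else 0 := by
    split_ifs with hij
    · rw [hij, h1]
    · exact h0 i j hij
  simp [map_sum, LinearMap.sum_apply, h]

theorem linearIndependent_of_bilin (h1 : ∀ i, B (b i) (b i) = 1)
    (h0 : ∀ i j, i ≠ j → B (b i) (b j) = 0) : LinearIndependent ℝ b := by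
  classical
  rw [linearIndependent_iff']
  intro s c hc i hi
  have := bilin_sum_smul h1 h0 s c i
  rw [hc, if_pos hi] at this
  simpa using this.symm

/-- A vector orthogonal to a total family vanishes. -/
theorem eq_zero_of_orthogonal_of_dense (hsymm : ∀ x y, B x y = B y x) (hnn : ∀ x, 0 ≤ B x x)
    (hdef : ∀ x, B x x = 0 → x = 0)
    (hd : ∀ x, ∀ ε : ℝ, 0 < ε → ∃ w ∈ Submodule.span ℝ (Set.range b), B (x - w) (x - w) < ε)
    {x : E} (hx : ∀ i, B x (b i) = 0) : x = 0 := by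
  have hw : ∀ w ∈ Submodule.span ℝ (Set.range b), B x w = 0 := by
    intro w hw
    have hle : Submodule.span ℝ (Set.range b) ≤ LinearMap.ker (B x) := by
      rw [Submodule.span_le]
      rintro _ ⟨i, rfl⟩
      exact hx i
    exact hle hw
  refine hdef x (le_antisymm (le_of_forall_pos_lt_add fun ε hε => ?_) (hnn x))
  -- Since `x` is orthogonal to `w`, `B (x - w) (x - w) = B x x + B w w ≥ B x x`.
  obtain ⟨w, hw', hlt⟩ := hd x ε hε
  have h1 := hw w hw'
  have h2 := hsymm w x
  simp only [map_sub, LinearMap.sub_apply] at hlt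
  linarith [hnn w]

/-- The eigenspaces of a symmetric operator with a total orthonormal family of eigenvectors are
spanned by members of the family. -/
theorem eigenspace_eq_span (hsymm : ∀ x y, B x y = B y x) (hnn : ∀ x, 0 ≤ B x x)
    (hdef : ∀ x, B x x = 0 → x = 0) (hT : ∀ x y, B (T x) y = B x (T y))
    (hTb : ∀ i, T (b i) = lam i • b i) (h1 : ∀ i, B (b i) (b i) = 1)
    (h0 : ∀ i j, i ≠ j → B (b i) (b j) = 0)
    (hd : ∀ x, ∀ ε : ℝ, 0 < ε → ∃ w ∈ Submodule.span ℝ (Set.range b), B (x - w) (x - w) < ε)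
    (μ : ℝ) (s : Finset ι) (hs : ∀ i, i ∈ s ↔ lam i = μ) :
    T.eigenspace μ = Submodule.span ℝ (b '' s) := by
  classical
  apply le_antisymm
  · intro x hx
    rw [Module.End.mem_eigenspace_iff] at hx
    have hc (i : ι) : (μ - lam i) * B x (b i) = 0 := by
      have h := hT x (b i)
      rw [hx, hTb] at h
      simp only [map_smul, LinearMap.smul_apply, smul_eq_mul] at h
      linarith
    -- The remainder is orthogonal to members in `s` by construction, and to the others by `hc`.
    have hz : x - ∑ i ∈ s, B x (b i) • b i = 0 := by
      refine eq_zero_of_orthogonal_of_dense hsymm hnn hdef hd fun j => ?_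
      rw [map_sub, LinearMap.sub_apply, bilin_sum_smul h1 h0]
      split_ifs with hj
      · exact sub_self _
      · have : μ - lam j ≠ 0 := fun h => hj ((hs j).2 (by linarith))
        simpa using (mul_eq_zero.1 (hc j)).resolve_left this
    rw [sub_eq_zero.1 hz]
    exact Submodule.sum_mem _ fun i hi =>
      Submodule.smul_mem _ _ (Submodule.subset_span ⟨i, hi, rfl⟩)
  · rw [Submodule.span_le]
    rintro _ ⟨i, hi, rfl⟩
    rw [SetLike.mem_coe, Module.End.mem_eigenspace_iff, hTb, (hs i).1 hi]

theorem finrank_span_image_of_bilin (h1 : ∀ i, B (b i) (b i) = 1)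
    (h0 : ∀ i j, i ≠ j → B (b i) (b j) = 0) (s : Finset ι) :
    Module.finrank ℝ (Submodule.span ℝ (b '' s)) = s.card := by
  have hli : LinearIndependent ℝ fun i : s => b i :=
    (linearIndependent_of_bilin h1 h0).comp _ Subtype.val_injective
  have h := finrank_span_eq_card hli
  rw [Fintype.card_coe] at h
  rwa [show Set.range (fun i : s => b i) = b '' s by ext x; simp] at h

end Abstract

/-! ### Eigenvectors and eigenvalues on the span of a mode -/

section Diagonalization

/-- The diagonal entry of `I₂` on a mode in the direction `N`. -/
def normalEntry (k : ℕ) (i j : ℤ) : ℝ := (i ^ 2 + j ^ 2) ^ 2 + 2 * k ^ 2 * i ^ 2 - k ^ 4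

/-- The difference of the diagonal entries of `I₂` on a mode. -/
def diagGap (k : ℕ) (i j : ℤ) : ℝ := k ^ 2 * (i ^ 2 + j ^ 2) + k ^ 4

/-- The off-diagonal entry of `I₂` on a mode. -/
def offDiag (k : ℕ) (i j : ℤ) : ℝ := -(4 * speed k * (i ^ 2 + j ^ 2) * i)

/-- The positive root of `x² - diagGap x - offDiag² = 0`. -/
def shift (k : ℕ) (i j : ℤ) : ℝ := (diagGap k i j + √(diagGap k i j ^ 2 + 4 * offDiag k i j ^ 2)) / 2

/-- The eigenvalues of `I₂` on a mode, the larger for `true`, the smaller for `false`. -/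
def modeEigenvalue (k : ℕ) (x : Bool × ℤ × ℤ) : ℝ :=
  if x.1 then normalEntry k x.2.1 x.2.2 + shift k x.2.1 x.2.2
  else normalEntry k x.2.1 x.2.2 + diagGap k x.2.1 x.2.2 - shift k x.2.1 x.2.2

variable {k : ℕ} (i j : ℤ)

theorem shift_sq (k : ℕ) : shift k i j ^ 2 = diagGap k i j * shift k i j + offDiag k i j ^ 2 := by
  have h : √(diagGap k i j ^ 2 + 4 * offDiag k i j ^ 2) ^ 2
      = diagGap k i j ^ 2 + 4 * offDiag k i j ^ 2 := Real.sq_sqrt (by positivity)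
  rw [shift]
  linear_combination h / 4

theorem diagGap_pos (hk : 1 ≤ k) : 0 < diagGap k i j := by
  have : (0 : ℝ) < k := by exact_mod_cast hk
  rw [diagGap]
  positivity

/-- Keeps the eigenvector `(shift, offDiag)` nonzero even where the off-diagonal entry vanishes. -/
theorem shift_pos (hk : 1 ≤ k) : 0 < shift k i j := by
  have := diagGap_pos i j hk
  rw [shift]
  positivity

/-- The coefficients of the unit eigenvector for the larger eigenvalue. -/
def eigenCoeff (k : ℕ) (i j : ℤ) : ℝ × ℝ :=
  ((√(shift k i j ^ 2 + offDiag k i j ^ 2))⁻¹ * shift k i j,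
    (√(shift k i j ^ 2 + offDiag k i j ^ 2))⁻¹ * offDiag k i j)

theorem eigenCoeff_sq_add_sq (hk : 1 ≤ k) :
    (eigenCoeff k i j).1 ^ 2 + (eigenCoeff k i j).2 ^ 2 = 1 := by
  have h0 := shift_pos i j hk
  have h1 : 0 < shift k i j ^ 2 + offDiag k i j ^ 2 := by positivity
  simp only [eigenCoeff, mul_pow, inv_pow, Real.sq_sqrt h1.le]
  field_simp

/-- The unit eigensections of `I₂`. -/
def eigenSection (k : ℕ) (x : Bool × ℤ × ℤ) : sections (phi k) :=
  if x.1 then modeSection k x.2.1 x.2.2 (eigenCoeff k x.2.1 x.2.2).1 (eigenCoeff k x.2.1 x.2.2).2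
  else modeSection k x.2.1 x.2.2 (-(eigenCoeff k x.2.1 x.2.2).2) (eigenCoeff k x.2.1 x.2.2).1

theorem I₂_modeSection (k : ℕ) (A B : ℝ) : I₂ (phi k) (modeSection k i j A B)
    = modeSection k i j ((normalEntry k i j + diagGap k i j) * A + offDiag k i j * B)
      (normalEntry k i j * B + offDiag k i j * A) := by
  apply Subtype.ext
  change secondVariation (phi k) (mode k i j A B) = mode k i j _ _
  rw [secondVariation_mode]
  congr 1 <;> simp only [normalEntry, diagGap, offDiag] <;> ring

theorem smul_modeSection (k : ℕ) (c A B : ℝ) :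
    c • modeSection k i j A B = modeSection k i j (c * A) (c * B) := by
  apply Subtype.ext
  funext p
  simp only [modeSection, Submodule.coe_smul, Pi.smul_apply, mode_apply]
  module

theorem modeSection_add (k : ℕ) (A B A' B' : ℝ) :
    modeSection k i j A B + modeSection k i j A' B' = modeSection k i j (A + A') (B + B') := by
  apply Subtype.ext
  funext p
  simp only [modeSection, Submodule.coe_add, Pi.add_apply, mode_apply]
  module

/-- Up to `normalEntry` times the identity, the matrix is `[[g, o], [o, 0]]`. If `x² = g x + o²`,
then `(x, o)` is an eigenvector for `x` and `(-o, x)` for `g - x`. -/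
theorem I₂_eigenSection (k : ℕ) (x : Bool × ℤ × ℤ) :
    I₂ (phi k) (eigenSection k x) = modeEigenvalue k x • eigenSection k x := by
  obtain ⟨s, i, j⟩ := x
  have h := shift_sq i j k
  cases s
  · simp only [eigenSection, modeEigenvalue, Bool.false_eq_true, if_false, I₂_modeSection,
      smul_modeSection, eigenCoeff]
    congr 1
    · ring
    · linear_combination (√(shift k i j ^ 2 + offDiag k i j ^ 2))⁻¹ * h
  · simp only [eigenSection, modeEigenvalue, if_true, I₂_modeSection,
      smul_modeSection, eigenCoeff]
    congr 1
    · linear_combination -(√(shift k i j ^ 2 + offDiag k i j ^ 2))⁻¹ * h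
    · ring

theorem innerL2_modeSection (k : ℕ) (i j i' j' : ℤ) (A B A' B' : ℝ) :
    innerL2 (modeSection k i j A B) (modeSection k i' j' A' B')
      = if i = i' ∧ j = j' then A * A' + B * B' else 0 :=
  pairL2_mode k i j i' j' A B A' B'

theorem innerL2_eigenSection_self (hk : 1 ≤ k) (x : Bool × ℤ × ℤ) :
    innerL2 (eigenSection k x) (eigenSection k x) = 1 := by
  obtain ⟨s, i, j⟩ := x
  have h := eigenCoeff_sq_add_sq i j hk
  cases s <;> simp [eigenSection, innerL2_modeSection] <;> linarith

theorem innerL2_eigenSection_of_ne (k : ℕ) {x y : Bool × ℤ × ℤ} (hxy : x ≠ y) :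
    innerL2 (eigenSection k x) (eigenSection k y) = 0 := by
  obtain ⟨s, i, j⟩ := x
  obtain ⟨s', i', j'⟩ := y
  by_cases hij : i = i' ∧ j = j'
  · obtain ⟨rfl, rfl⟩ := hij
    cases s <;> cases s' <;> simp [eigenSection, innerL2_modeSection] at hxy ⊢ <;> ring
  · cases s <;> cases s' <;> simp [eigenSection, innerL2_modeSection, hij]

theorem modeSpan_le_span_eigenSection (hk : 1 ≤ k) :
    modeSpan k ≤ Submodule.span ℝ (Set.range (eigenSection k)) := by
  rw [modeSpan, Submodule.span_le]
  rintro _ ⟨⟨⟨i, j⟩, A, B⟩, rfl⟩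
  have h := eigenCoeff_sq_add_sq i j hk
  have e : modeSection k i j A B
      = (A * (eigenCoeff k i j).1 + B * (eigenCoeff k i j).2) • eigenSection k (true, i, j)
        + (B * (eigenCoeff k i j).1 - A * (eigenCoeff k i j).2) • eigenSection k (false, i, j) := by
    simp only [eigenSection, if_true, Bool.false_eq_true, if_false, smul_modeSection,
      modeSection_add]
    congr 1
    · linear_combination -A * h
    · linear_combination -B * h
  simp only [SetLike.mem_coe]
  rw [e]
  exact Submodule.add_mem _ (Submodule.smul_mem _ _ (Submodule.subset_span ⟨_, rfl⟩))
    (Submodule.smul_mem _ _ (Submodule.subset_span ⟨_, rfl⟩))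

/-- With `L = i² + j²`, both eigenvalues are at least `normalEntry - |offDiag|`, and the coupling is
absorbed by `4 speed L |i| ≤ L²/2 + 8 speed² i²`. -/
theorem le_modeEigenvalue (hk : 1 ≤ k) (s : Bool) :
    ((i : ℝ) ^ 2 + j ^ 2) ^ 2 / 2 - 2 * k ^ 2 * (i ^ 2 + j ^ 2) - k ^ 4
      ≤ modeEigenvalue k (s, i, j) := by
  have hg := diagGap_pos i j hk
  have h1 : √(diagGap k i j ^ 2 + 4 * offDiag k i j ^ 2) ≤ diagGap k i j + 2 * |offDiag k i j| := by
    rw [Real.sqrt_le_left (by positivity)]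
    nlinarith [sq_abs (offDiag k i j), mul_nonneg hg.le (abs_nonneg (offDiag k i j))]
  have h2 : diagGap k i j ≤ √(diagGap k i j ^ 2 + 4 * offDiag k i j ^ 2) :=
    Real.le_sqrt_of_sq_le (by nlinarith [sq_nonneg (offDiag k i j)])
  have h3 : |offDiag k i j| ≤ ((i : ℝ) ^ 2 + j ^ 2) ^ 2 / 2 + 4 * k ^ 2 * i ^ 2 := by
    have hs := speed_sq k
    rw [offDiag, abs_neg, abs_le]
    constructor
    · nlinarith [sq_nonneg (((i : ℝ) ^ 2 + j ^ 2) + 4 * speed k * i)]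
    · nlinarith [sq_nonneg (((i : ℝ) ^ 2 + j ^ 2) - 4 * speed k * i)]
  have h4 : 0 ≤ 2 * (k : ℝ) ^ 2 * j ^ 2 := by positivity
  cases s <;> simp only [modeEigenvalue, shift, normalEntry, if_true, Bool.false_eq_true,
    if_false] <;> linarith

theorem finite_modeEigenvalue_eq (hk : 1 ≤ k) (μ : ℝ) :
    {x : Bool × ℤ × ℤ | modeEigenvalue k x = μ}.Finite := by
  -- If `L = i² + j² > C`, then `L ≥ 1` and `L (L - 4k²) > 2k⁴ + 2|μ|`, so the lower bound exceeds
  -- `μ`.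
  set C : ℝ := 4 * k ^ 2 + 2 * k ^ 4 + 2 * |μ| + 1 with hC
  refine ((Set.finite_univ (α := Bool)).prod ((Set.finite_Icc (-⌈C⌉) ⌈C⌉).prod
    (Set.finite_Icc (-⌈C⌉) ⌈C⌉))).subset ?_
  rintro ⟨s, i, j⟩ hx
  have h := le_modeEigenvalue i j hk s
  rw [show modeEigenvalue k (s, i, j) = μ from hx] at h
  have hL : (i : ℝ) ^ 2 + j ^ 2 ≤ C := by
    by_contra! hlt
    have hk0 : (0 : ℝ) ≤ k ^ 2 := by positivity
    have hk4 : (0 : ℝ) ≤ k ^ 4 := by positivity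
    have hμ := le_abs_self μ
    have hμ0 := abs_nonneg μ
    have h1 : (1 : ℝ) ≤ (i : ℝ) ^ 2 + j ^ 2 := by linarith
    nlinarith [mul_nonneg (sub_nonneg.2 h1) hk4, mul_nonneg (sub_nonneg.2 h1) hμ0]
  have key (a b : ℤ) (hab : (a : ℝ) ^ 2 + b ^ 2 ≤ C) : a ∈ Set.Icc (-⌈C⌉) ⌈C⌉ := by
    have h1 : ((a ^ 2 : ℤ) : ℝ) ≤ (⌈C⌉ : ℤ) := by
      have := Int.le_ceil C
      push_cast
      nlinarith [sq_nonneg (b : ℝ)]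
    have h2 : a ^ 2 ≤ ⌈C⌉ := by exact_mod_cast h1
    have h3 := Int.le_self_sq a
    have h4 := Int.le_self_sq (-a)
    rw [neg_sq] at h4
    constructor <;> linarith
  exact ⟨trivial, key i j hL, key j i (by linarith)⟩

end Diagonalization

/-! ### The list of eigenvalues -/

/-- The entry of the list to which the eigensection of index `(s, i, j)` belongs. -/
def toIndex (x : Bool × ℤ × ℤ) : SpectralIndex :=
  if h : (x.2.1.natAbs, x.2.2.natAbs) = (0, 0) then (if x.1 then .mu0 else .mu1)
  else if x.1 then .lamPlus x.2.1.natAbs x.2.2.natAbs h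
  else .lamMinus x.2.1.natAbs x.2.2.natAbs h

theorem sqrt_disc (k : ℕ) (i j : ℤ) : √(diagGap k i j ^ 2 + 4 * offDiag k i j ^ 2)
    = √((k : ℝ) ^ 8 + 2 * k ^ 6 * (i ^ 2 + j ^ 2) + k ^ 4 * ((i : ℝ) ^ 2 + j ^ 2) ^ 2
          + 32 * k ^ 2 * i ^ 2 * ((i : ℝ) ^ 2 + j ^ 2) ^ 2) := by
  congr 1
  have := speed_sq k
  simp only [diagGap, offDiag]
  linear_combination 64 * ((i : ℝ) ^ 2 + j ^ 2) ^ 2 * i ^ 2 * this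

theorem modeEigenvalue_eq (k : ℕ) (s : Bool) (i j : ℤ) : modeEigenvalue k (s, i, j)
    = 1 / 2 * (-(k : ℝ) ^ 4 + k ^ 2 * (5 * i ^ 2 + j ^ 2) + 2 * ((i : ℝ) ^ 2 + j ^ 2) ^ 2
      + (if s then 1 else -1) *
        √((k : ℝ) ^ 8 + 2 * k ^ 6 * (i ^ 2 + j ^ 2) + k ^ 4 * ((i : ℝ) ^ 2 + j ^ 2) ^ 2
          + 32 * k ^ 2 * i ^ 2 * ((i : ℝ) ^ 2 + j ^ 2) ^ 2)) := by
  rw [← sqrt_disc]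
  cases s <;> simp only [modeEigenvalue, shift, normalEntry, if_true, Bool.false_eq_true,
    if_false] <;> generalize √(diagGap k i j ^ 2 + 4 * offDiag k i j ^ 2) = d <;>
    simp only [diagGap] <;> ring

/-- At `i = 0` the tangential and normal parts decouple and the discriminant is a perfect square;
this yields the polynomial entries, including `μ₀` and `μ₁` at `j = 0`. -/
theorem sqrt_disc_zero (k : ℕ) (j : ℝ) :
    √((k : ℝ) ^ 8 + 2 * k ^ 6 * (0 ^ 2 + j ^ 2) + k ^ 4 * ((0 : ℝ) ^ 2 + j ^ 2) ^ 2
      + 32 * k ^ 2 * 0 ^ 2 * ((0 : ℝ) ^ 2 + j ^ 2) ^ 2) = k ^ 4 + k ^ 2 * j ^ 2 := by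
  rw [Real.sqrt_eq_iff_mul_self_eq (by positivity) (by positivity)]
  ring

theorem value_toIndex (k : ℕ) (x : Bool × ℤ × ℤ) : (toIndex x).value k = modeEigenvalue k x := by
  obtain ⟨s, i, j⟩ := x
  have hc (i : ℤ) : ((i.natAbs : ℕ) : ℝ) ^ 2 = (i : ℝ) ^ 2 := by
    rw [Nat.cast_natAbs, Int.cast_abs, sq_abs]
  rw [modeEigenvalue_eq]
  by_cases h : i = 0
  · subst h
    have hs := sqrt_disc_zero k j
    push_cast
    rw [hs]
    by_cases h' : j = 0
    · subst h'
      cases s <;> simp [toIndex, SpectralIndex.value]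
      ring
    · have hc4 : ((j.natAbs : ℕ) : ℝ) ^ 4 = (j : ℝ) ^ 4 := by
        rw [show ((j.natAbs : ℕ) : ℝ) ^ 4 = (((j.natAbs : ℕ) : ℝ) ^ 2) ^ 2 by ring, hc]; ring
      cases s <;> simp only [toIndex, Int.natAbs_zero, Prod.mk.injEq, Int.natAbs_eq_zero, h',
        and_false, dite_false, Bool.false_eq_true, if_true, if_false, SpectralIndex.value,
        lambdaPlus, lambdaMinus, hc, hc4] <;> ring
  · have hd : 2 * (k : ℝ) ^ 6 * (i ^ 2 + 0 ^ 2) + k ^ 4 * ((i : ℝ) ^ 2 + 0 ^ 2) ^ 2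
          + 32 * k ^ 2 * i ^ 2 * ((i : ℝ) ^ 2 + 0 ^ 2) ^ 2
        = 2 * k ^ 6 * i ^ 2 + k ^ 4 * i ^ 4 + 32 * k ^ 2 * i ^ 6 := by ring
    have hc4 : ((i.natAbs : ℕ) : ℝ) ^ 4 = (i : ℝ) ^ 4 := by
      rw [show ((i.natAbs : ℕ) : ℝ) ^ 4 = (((i.natAbs : ℕ) : ℝ) ^ 2) ^ 2 by ring, hc]; ring
    have hc6 : ((i.natAbs : ℕ) : ℝ) ^ 6 = (i : ℝ) ^ 6 := by
      rw [show ((i.natAbs : ℕ) : ℝ) ^ 6 = (((i.natAbs : ℕ) : ℝ) ^ 2) ^ 3 by ring, hc]; ring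
    by_cases h' : j = 0
    · subst h'
      cases s <;> simp only [toIndex, Int.natAbs_zero, Prod.mk.injEq, Int.natAbs_eq_zero, h,
        false_and, dite_false, Bool.false_eq_true, if_true, if_false, SpectralIndex.value,
        lambdaPlus, lambdaMinus, hc, hc4, hc6, Int.cast_zero] <;> ring_nf
    · cases s <;> simp only [toIndex, Prod.mk.injEq, Int.natAbs_eq_zero, h, h',
        false_and, dite_false, Bool.false_eq_true, if_true, if_false, SpectralIndex.value,
        lambdaPlus, lambdaMinus, hc] <;> ring

theorem mult_pos (l : SpectralIndex) : 0 < l.mult := by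
  cases l <;> simp only [SpectralIndex.mult] <;> (try split_ifs) <;> norm_num

theorem ncard_natAbs_eq (m : ℕ) : {i : ℤ | i.natAbs = m}.ncard = if m = 0 then 1 else 2 := by
  have e : {i : ℤ | i.natAbs = m} = {(m : ℤ), -(m : ℤ)} := by
    ext i
    exact Int.natAbs_eq_iff
  rw [e]
  split_ifs with h
  · simp [h]
  · exact Set.ncard_pair (by omega)

theorem ncard_fiber (m n : ℕ) (h : (m, n) ≠ (0, 0)) (s : Bool) :
    (({s} : Set Bool) ×ˢ ({i : ℤ | i.natAbs = m} ×ˢ {j : ℤ | j.natAbs = n})).ncard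
      = if m = 0 ∨ n = 0 then 2 else 4 := by
  rw [Set.ncard_prod, Set.ncard_prod, Set.ncard_singleton, ncard_natAbs_eq, ncard_natAbs_eq]
  by_cases hm : m = 0 <;> by_cases hn : n = 0 <;> simp [hm, hn] at h ⊢

/-- An entry fixes the branch and `|i|`, `|j|`; only the signs of the nonzero indices remain free.
-/
theorem card_fiber_toIndex (l : SpectralIndex) : Nat.card {x // toIndex x = l} = l.mult := by
  change Nat.card ({x | toIndex x = l} : Set _) = l.mult
  rw [Nat.card_coe_set_eq]
  cases l with
  | mu0 =>
    rw [show {x | toIndex x = SpectralIndex.mu0} = {(true, 0, 0)} by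
      ext ⟨s, i, j⟩
      cases s <;> simp only [toIndex, Set.mem_ofPred_eq] <;> split_ifs <;> simp_all]
    simp [SpectralIndex.mult]
  | mu1 =>
    rw [show {x | toIndex x = SpectralIndex.mu1} = {(false, 0, 0)} by
      ext ⟨s, i, j⟩
      cases s <;> simp only [toIndex, Set.mem_ofPred_eq] <;> split_ifs <;> simp_all]
    simp [SpectralIndex.mult]
  | lamPlus m n h =>
    rw [show {x | toIndex x = SpectralIndex.lamPlus m n h}
        = ({true} : Set Bool) ×ˢ ({i : ℤ | i.natAbs = m} ×ˢ {j : ℤ | j.natAbs = n}) by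
      ext ⟨s, i, j⟩
      cases s <;> simp only [toIndex, Set.mem_ofPred_eq] <;> split_ifs <;> simp_all
      omega]
    exact ncard_fiber m n h true
  | lamMinus m n h =>
    rw [show {x | toIndex x = SpectralIndex.lamMinus m n h}
        = ({false} : Set Bool) ×ˢ ({i : ℤ | i.natAbs = m} ×ˢ {j : ℤ | j.natAbs = n}) by
      ext ⟨s, i, j⟩
      cases s <;> simp only [toIndex, Set.mem_ofPred_eq] <;> split_ifs <;> simp_all
      omega]
    exact ncard_fiber m n h false

theorem finite_fiber_toIndex (l : SpectralIndex) : Finite {x // toIndex x = l} :=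
  Nat.finite_of_card_ne_zero (by rw [card_fiber_toIndex]; exact (mult_pos l).ne')

/-- The list of eigenvalues, with multiplicity, enumerates the eigensections. -/
def indexEquiv : (Σ l : SpectralIndex, Fin l.mult) ≃ Bool × ℤ × ℤ :=
  (Equiv.sigmaCongrRight fun l =>
    (@Finite.equivFinOfCardEq _ (finite_fiber_toIndex l) _ (card_fiber_toIndex l)).symm).trans
    (Equiv.sigmaFiberEquiv toIndex)

theorem toIndex_indexEquiv (x : Σ l : SpectralIndex, Fin l.mult) : toIndex (indexEquiv x) = x.1 :=
  ((@Finite.equivFinOfCardEq _ (finite_fiber_toIndex x.1) _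
    (card_fiber_toIndex x.1)).symm x.2).2

theorem modeEigenvalue_indexEquiv (k : ℕ) (x : Σ l : SpectralIndex, Fin l.mult) :
    modeEigenvalue k (indexEquiv x) = x.1.value k := by
  rw [← value_toIndex, toIndex_indexEquiv]

theorem finite_value_eq {k : ℕ} (hk : 1 ≤ k) (μ : ℝ) : {l : SpectralIndex | l.value k = μ}.Finite := by
  refine ((finite_modeEigenvalue_eq hk μ).image toIndex).subset fun l hl => ?_
  refine ⟨indexEquiv ⟨l, ⟨0, mult_pos l⟩⟩, ?_, toIndex_indexEquiv _⟩
  rw [Set.mem_ofPred_eq, modeEigenvalue_indexEquiv]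
  exact hl

/-- The `L²` inner product as a bilinear form on the space of sections. -/
def bilinL2 (φ : SphereMap) : LinearMap.BilinForm ℝ (sections φ) :=
  LinearMap.mk₂ ℝ innerL2
    (fun V V' W => pairL2_add_left V.2.1 V'.2.1 W.2.1)
    (fun c V W => pairL2_smul_left c V.1 W.1)
    (fun V W W' => pairL2_add_right W.2.1 W'.2.1 V.2.1)
    (fun c V W => by
      have h := pairL2_smul_left c W.1 V.1
      rw [pairL2_comm, pairL2_comm W.1] at h
      exact h)

theorem bilinL2_apply {φ : SphereMap} (V W : sections φ) : bilinL2 φ V W = innerL2 V W := rfl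

end BiharmonicTorus

end

/-! ### The spectrum of `I₂`. -/

open BiharmonicTorus in
theorem theorem1p2 (k : ℕ) (hk : 1 ≤ k) :
    (∀ μ : ℝ, (I₂ (phi k)).HasEigenvalue μ ↔ ∃ l : SpectralIndex, l.value k = μ) ∧
    (∀ μ : ℝ, FiniteDimensional ℝ ((I₂ (phi k)).eigenspace μ) ∧
      ∃ hfin : {l : SpectralIndex | l.value k = μ}.Finite,
        Module.finrank ℝ ((I₂ (phi k)).eigenspace μ) = ∑ l ∈ hfin.toFinset, l.mult) ∧
    (∃ b : (Σ l : SpectralIndex, Fin l.mult) → sections (phi k),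
      (∀ i, I₂ (phi k) (b i) = i.1.value k • b i) ∧
      (∀ i, innerL2 (b i) (b i) = 1) ∧
      (∀ i j, i ≠ j → innerL2 (b i) (b j) = 0) ∧
      (∀ V : sections (phi k), ∀ ε : ℝ, 0 < ε →
        ∃ W ∈ Submodule.span ℝ (Set.range b), innerL2 (V - W) (V - W) < ε)) := by
  set b : (Σ l : SpectralIndex, Fin l.mult) → sections (phi k) :=
    fun x => eigenSection k (indexEquiv x)
  have hTb : ∀ i, I₂ (phi k) (b i) = i.1.value k • b i := fun i => by
    rw [← modeEigenvalue_indexEquiv]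
    exact I₂_eigenSection k _
  have h1 : ∀ i, innerL2 (b i) (b i) = 1 := fun i => innerL2_eigenSection_self hk _
  have h0 : ∀ i j, i ≠ j → innerL2 (b i) (b j) = 0 := fun i j hij =>
    innerL2_eigenSection_of_ne k (indexEquiv.injective.ne hij)
  have hrange : Set.range b = Set.range (eigenSection k) :=
    indexEquiv.surjective.range_comp (eigenSection k)
  have hd : ∀ V : sections (phi k), ∀ ε : ℝ, 0 < ε →
      ∃ W ∈ Submodule.span ℝ (Set.range b), innerL2 (V - W) (V - W) < ε := by
    intro V ε hε
    obtain ⟨W, hW, hlt⟩ := exists_mem_modeSpan_pairL2_lt k V hε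
    exact ⟨W, hrange ▸ modeSpan_le_span_eigenSection hk hW, hlt⟩
  have hspan (μ : ℝ) (s : Finset (Σ l : SpectralIndex, Fin l.mult))
      (hs : ∀ i, i ∈ s ↔ i.1.value k = μ) :
      (I₂ (phi k)).eigenspace μ = Submodule.span ℝ (b '' s) :=
    eigenspace_eq_span (B := bilinL2 (phi k)) (fun V W => pairL2_comm V.1 W.1)
      innerL2_self_nonneg eq_zero_of_innerL2_self
      (fun V W => pairL2_secondVariation V.2 W.2) hTb h1 h0 hd μ s hs
  -- The sigma finset collects all family members with eigenvalue `μ`; its cardinality is the sum of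
  -- the multiplicities.
  have hmem (μ : ℝ) (i : Σ l : SpectralIndex, Fin l.mult) :
      i ∈ (finite_value_eq hk μ).toFinset.sigma (fun l => (Finset.univ : Finset (Fin l.mult)))
        ↔ i.1.value k = μ := by simp
  have hrank (μ : ℝ) : FiniteDimensional ℝ ((I₂ (phi k)).eigenspace μ) ∧
      ∃ hfin : {l : SpectralIndex | l.value k = μ}.Finite,
        Module.finrank ℝ ((I₂ (phi k)).eigenspace μ) = ∑ l ∈ hfin.toFinset, l.mult := by
    rw [hspan μ _ (hmem μ)]
    refine ⟨FiniteDimensional.span_of_finite ℝ (Finset.finite_toSet _ |>.image b),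
      finite_value_eq hk μ, ?_⟩
    rw [finrank_span_image_of_bilin (B := bilinL2 (phi k)) h1 h0]
    simp
  refine ⟨fun μ => ⟨fun hμ => ?_, ?_⟩, hrank, b, hTb, h1, h0, hd⟩
  · by_contra! hne
    apply hμ
    -- If no entry has value `μ`, the eigenspace is the span of the empty set.
    have hs := hspan μ ∅ (fun i => by simpa using hne i.1)
    simpa using hs
  · rintro ⟨l, rfl⟩
    refine Module.End.hasEigenvalue_of_hasEigenvector (x := b ⟨l, ⟨0, mult_pos l⟩⟩)
      ⟨Module.End.mem_eigenspace_iff.2 (hTb _), fun hz => ?_⟩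
    have h := h1 ⟨l, ⟨0, mult_pos l⟩⟩
    rw [hz, ← bilinL2_apply, map_zero] at h
    simp at h
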